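/- Graphs are finite, undirected and simple, $\mathrm{Aut}(X)$ is the automorphism group of a graph $X$, and $G'$ is the commutator subgroup of a group $G$. A group $G$ is *representable* on a graph $X$ if there is a homomorphism $G \to \mathrm{Aut}(X)$ that does not map all elements of $G$ to the identity. The *solvable group representability problem* is: given a finite solvable group $G$, by its multiplication table, and a graph $X$, by its adjacency matrix, decide whether $G$ is representable on $X$. The *graph isomorphism problem* is: given two graphs, by their adjacency matrices, decide whether they are isomorphic. **Theorem.** The solvable group representability problem is polynomial-time Turing reducible to the graph isomorphism problem: there are an oracle algorithm (a program of a unit-cost random access machine with addition and subtraction, on which a query costs in addition the bit length of the queried word) and a polynomial $p$ such that, with every oracle that correctly answers all instances of graph isomorphism, the algorithm correctly decides every instance of the solvable group representability problem in at most $p(s)$ steps, where $s$ is the bit length of the instance. Moreover, a finite solvable group $G$ is representable on a graph $X$ if and only if $\#(G/G')$ and $\#\mathrm{Aut}(X)$ have a common prime factor. -/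

import Mathlib

/-- Words over the natural numbers: the inputs of machines and the queries to oracles. -/
abbrev Word : Type := List ℕ

/-- The bit length of a word; every letter also counts one for a separator. -/
def wordSize (w : Word) : ℕ := (w.map fun a => Nat.size a + 1).sum

/-! ### Oracle random access machines

The unit-cost RAM with addition and truncated subtraction as its only arithmetic operations and
with indirect addressing. Control is structured. A program is a finite term, so it mentions only
finitely many registers and memory banks. -/

namespace OracleRAM

/-- A machine state: the registers, and the memory banks with their cells `mem a i`. -/
structure State where
  reg : ℕ → ℕ
  mem : ℕ → ℕ → ℕ

/-- Assign a value to a register. -/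
def State.setReg (s : State) (x v : ℕ) : State :=
  { s with reg := Function.update s.reg x v }

/-- Assign a value to the cell `i` of the memory bank `a`. -/
def State.setMem (s : State) (a i v : ℕ) : State :=
  { s with mem := Function.update s.mem a (Function.update (s.mem a) i v) }

/-- The word in the first `k` cells of the memory bank `a`. -/
def State.word (s : State) (a k : ℕ) : Word := (List.range k).map (s.mem a)

/-- Programs. Here `x`, `y`, `z` are names of registers, `a` is the name of a memory bank. -/
inductive Prog : Type
  /-- do nothing -/
  | skip
  /-- `x := c` -/
  | const (x c : ℕ)
  /-- `x := y + z` -/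
  | add (x y z : ℕ)
  /-- `x := y - z`, truncated at zero -/
  | sub (x y z : ℕ)
  /-- `x := a[y]` -/
  | load (x a y : ℕ)
  /-- `a[x] := y` -/
  | store (a x y : ℕ)
  /-- `x := 1` if the oracle contains the word `a[0], …, a[y - 1]`, and `x := 0` otherwise -/
  | query (x a y : ℕ)
  /-- first `P`, then `Q` -/
  | seq (P Q : Prog)
  /-- `P` if `x ≠ 0`, and `Q` otherwise -/
  | ite (x : ℕ) (P Q : Prog)
  /-- repeat `P` as long as `x ≠ 0` -/
  | loop (x : ℕ) (P : Prog)

/-- `Exec O P s t s'`: with the oracle `O`, the program `P` started in the state `s` halts in the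
state `s'` after exactly `t` steps. Every assignment and every test is one step; a query costs in
addition the bit length of the word that is submitted. -/
inductive Exec (O : Set Word) : Prog → State → ℕ → State → Prop
  | skip (s : State) : Exec O .skip s 1 s
  | const (s : State) (x c : ℕ) : Exec O (.const x c) s 1 (s.setReg x c)
  | add (s : State) (x y z : ℕ) : Exec O (.add x y z) s 1 (s.setReg x (s.reg y + s.reg z))
  | sub (s : State) (x y z : ℕ) : Exec O (.sub x y z) s 1 (s.setReg x (s.reg y - s.reg z))
  | load (s : State) (x a y : ℕ) : Exec O (.load x a y) s 1 (s.setReg x (s.mem a (s.reg y)))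
  | store (s : State) (a x y : ℕ) : Exec O (.store a x y) s 1 (s.setMem a (s.reg x) (s.reg y))
  | query_yes (s : State) (x a y : ℕ) (h : s.word a (s.reg y) ∈ O) :
      Exec O (.query x a y) s (1 + wordSize (s.word a (s.reg y))) (s.setReg x 1)
  | query_no (s : State) (x a y : ℕ) (h : s.word a (s.reg y) ∉ O) :
      Exec O (.query x a y) s (1 + wordSize (s.word a (s.reg y))) (s.setReg x 0)
  | seq {P Q : Prog} {s s₁ s₂ : State} {t₁ t₂ : ℕ} (h₁ : Exec O P s t₁ s₁)
      (h₂ : Exec O Q s₁ t₂ s₂) : Exec O (.seq P Q) s (t₁ + t₂) s₂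
  | ite_true {x : ℕ} {P Q : Prog} {s s' : State} {t : ℕ} (hx : s.reg x ≠ 0)
      (h : Exec O P s t s') : Exec O (.ite x P Q) s (1 + t) s'
  | ite_false {x : ℕ} {P Q : Prog} {s s' : State} {t : ℕ} (hx : s.reg x = 0)
      (h : Exec O Q s t s') : Exec O (.ite x P Q) s (1 + t) s'
  | loop_done {x : ℕ} {P : Prog} {s : State} (hx : s.reg x = 0) : Exec O (.loop x P) s 1 s
  | loop_step {x : ℕ} {P : Prog} {s s₁ s₂ : State} {t₁ t₂ : ℕ} (hx : s.reg x ≠ 0)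
      (h₁ : Exec O P s t₁ s₁) (h₂ : Exec O (.loop x P) s₁ t₂ s₂) :
      Exec O (.loop x P) s (1 + t₁ + t₂) s₂

/-- The machine is deterministic: running time and final state are determined by the program, the
oracle and the initial state. -/
theorem Exec.unique {O : Set Word} {P : Prog} {s s₁ s₂ : State} {t₁ t₂ : ℕ}
    (h₁ : Exec O P s t₁ s₁) (h₂ : Exec O P s t₂ s₂) : t₁ = t₂ ∧ s₁ = s₂ := by
  induction h₁ generalizing t₂ s₂ with
  | skip | const | add | sub | load | store => cases h₂; exact ⟨rfl, rfl⟩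
  | query_yes s x a y h => cases h₂ with
    | query_yes => exact ⟨rfl, rfl⟩
    | query_no _ _ _ _ h' => exact absurd h h'
  | query_no s x a y h => cases h₂ with
    | query_yes _ _ _ _ h' => exact absurd h' h
    | query_no => exact ⟨rfl, rfl⟩
  | seq _ _ ih₁ ih₂ => cases h₂ with
    | seq k₁ k₂ =>
      obtain ⟨rfl, rfl⟩ := ih₁ k₁
      obtain ⟨rfl, rfl⟩ := ih₂ k₂
      exact ⟨rfl, rfl⟩
  | ite_true hx _ ih => cases h₂ with
    | ite_true _ k => obtain ⟨rfl, rfl⟩ := ih k; exact ⟨rfl, rfl⟩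
    | ite_false hx' _ => exact absurd hx' hx
  | ite_false hx _ ih => cases h₂ with
    | ite_true hx' _ => exact absurd hx hx'
    | ite_false _ k => obtain ⟨rfl, rfl⟩ := ih k; exact ⟨rfl, rfl⟩
  | loop_done hx => cases h₂ with
    | loop_done => exact ⟨rfl, rfl⟩
    | loop_step hx' _ _ => exact absurd hx hx'
  | loop_step hx _ _ ih₁ ih₂ => cases h₂ with
    | loop_done hx' => exact absurd hx' hx
    | loop_step _ k₁ k₂ =>
      obtain ⟨rfl, rfl⟩ := ih₁ k₁
      obtain ⟨rfl, rfl⟩ := ih₂ k₂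
      exact ⟨rfl, rfl⟩

/-- The initial state on the input `w`: its length is in register `0`, its letters are in the
memory bank `0`, and everything else is zero. -/
def init (w : Word) : State where
  reg := fun x => if x = 0 then w.length else 0
  mem := fun a i => if a = 0 then w.getD i 0 else 0

end OracleRAM

/-! ### Decision problems and reductions -/

/-- A decision problem: the words that encode instances, and among them the words that encode
instances with the answer yes. -/
structure DecisionProblem where
  instances : Set Word
  yes : Set Word
  yes_subset : yes ⊆ instances

/-- `A` is polynomial-time Turing reducible to `B`: one oracle program decides `A`, within a number
of steps that is polynomial in the bit length of the input, with every oracle that answers all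
instances of `B` correctly. The answer is yes if register `0` is nonzero on halting. -/
def PolyTimeTuringReducible (A B : DecisionProblem) : Prop :=
  ∃ (P : OracleRAM.Prog) (p : Polynomial ℕ),
    ∀ O : Set Word, (∀ q ∈ B.instances, q ∈ O ↔ q ∈ B.yes) →
      ∀ w ∈ A.instances, ∃ (t : ℕ) (s : OracleRAM.State),
        OracleRAM.Exec O P (OracleRAM.init w) t s ∧ t ≤ p.eval (wordSize w) ∧
          (s.reg 0 ≠ 0 ↔ w ∈ A.yes)

/-! ### Groups and graphs as inputs -/

/-- The multiplication table, row by row, of a finite group whose elements are numbered by `e`. -/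
def tableWord {G : Type} [Group G] {m : ℕ} (e : Fin m ≃ G) : Word :=
  (List.finRange m).flatMap fun i => (List.finRange m).map fun j => (e.symm (e i * e j) : ℕ)

open Classical in
/-- The adjacency matrix, row by row, of a graph with the vertices `0, …, n - 1`. -/
noncomputable def adjWord {n : ℕ} (X : SimpleGraph (Fin n)) : Word :=
  (List.finRange n).flatMap fun i => (List.finRange n).map fun j => if X.Adj i j then 1 else 0

/-- The order of the group, the number of vertices, the multiplication table, the adjacency
matrix. -/
noncomputable def groupGraphWord {G : Type} [Group G] {m n : ℕ} (e : Fin m ≃ G)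
    (X : SimpleGraph (Fin n)) : Word :=
  m :: n :: (tableWord e ++ adjWord X)

/-- The two numbers of vertices, and the two adjacency matrices. -/
noncomputable def graphPairWord {n k : ℕ} (X : SimpleGraph (Fin n)) (Y : SimpleGraph (Fin k)) :
    Word :=
  n :: k :: (adjWord X ++ adjWord Y)

/-- `G` is representable on `X`: there is a homomorphism from `G` to the automorphism group of `X`
that does not map all elements to the identity. -/
def Representable (G : Type*) [Group G] {V : Type*} (X : SimpleGraph V) : Prop :=
  ∃ ρ : G →* (X ≃g X), ∃ g : G, ρ g ≠ 1

/-- Given a finite solvable group by its multiplication table and a finite graph, decide whether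
the group is representable on the graph. -/
def solvableRepresentability : DecisionProblem where
  instances := {w | ∃ (G : Type) (_ : Group G) (m n : ℕ) (e : Fin m ≃ G) (X : SimpleGraph (Fin n)),
    Group.IsSolvable G ∧ w = groupGraphWord e X}
  yes := {w | ∃ (G : Type) (_ : Group G) (m n : ℕ) (e : Fin m ≃ G) (X : SimpleGraph (Fin n)),
    Group.IsSolvable G ∧ w = groupGraphWord e X ∧ Representable G X}
  yes_subset := by
    rintro w ⟨G, i, m, n, e, X, hG, hw, -⟩
    exact ⟨G, i, m, n, e, X, hG, hw⟩

/-- Given two finite graphs, decide whether they are isomorphic. -/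
def graphIsomorphism : DecisionProblem where
  instances := {w | ∃ (n k : ℕ) (X : SimpleGraph (Fin n)) (Y : SimpleGraph (Fin k)),
    w = graphPairWord X Y}
  yes := {w | ∃ (n k : ℕ) (X : SimpleGraph (Fin n)) (Y : SimpleGraph (Fin k)),
    w = graphPairWord X Y ∧ Nonempty (X ≃g Y)}
  yes_subset := by
    rintro w ⟨n, k, X, Y, hw, -⟩
    exact ⟨n, k, X, Y, hw⟩

/-! Criterion. If `ρ` is a nontrivial homomorphism from `G` to `Aut X`, its image is a nontrivial
solvable group and so has a nontrivial abelianization. The order of that abelianization divides the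
order of `G/G'`, because `G/G'` maps onto it, and it divides the order of `Aut X`, because it is the
index of a subgroup of the image. Any prime factor of it is common to both. Conversely, if `p`
divides both orders, then `G/G'` maps nontrivially to the cyclic group of order `p`, which embeds
into `Aut X` by Cauchy's theorem (`representable_iff_common_prime`).

Reduction. By the criterion it suffices to compare two orders. The order of `G'` is found from the
multiplication table: mark all commutators, then repeatedly mark products of marked elements until
the set is closed (`eval_commutatorOrder`). The order of `Aut X` can be exponential, but along the
chain of pointwise stabilizers of `0, …, i - 1` it is a product of `n` orbit lengths, each at most
`n` (`SimpleGraph.card_aut_eq_prod`). A prime divides the product if and only if it divides one of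
the lengths, so trial divisors up to `n` suffice (`exists_common_divisor_iff`). Whether `j` lies in
the orbit of `i` is one isomorphism query: attach different numbers of pendant vertices to `0, …, i
- 1` and to `i`, respectively `j`, so that an isomorphism must fix the former and map `i` to `j`
(`SimpleGraph.nonempty_iso_markedGraph_iff`).

Running time. The algorithm is written in a language of bounded loops that is compiled to the
machine with a bound on the number of steps (`OracleRAM.Cmd.exec`). Every loop is bounded by one of
five variables that are never changed after the input sizes are read, and these values are linear in
the bit length because the input contains full tables. With polynomially bounded queries, this gives
polynomial time (`OracleRAM.Cmd.cost_le_timeBound`). -/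

/-! ### Representability of solvable groups -/

/-- Homomorphisms to `ZMod p` separate the points of a commutative group of exponent `p`. -/
theorem exists_addHom_zmod_ne_zero {M : Type*} [AddCommGroup M] {p : ℕ} [Fact p.Prime]
    (hM : ∀ x : M, p • x = 0) {x : M} (hx : x ≠ 0) : ∃ f : M →+ ZMod p, f x ≠ 0 := by
  -- Linear functionals on a vector space over `ZMod p` separate points. The vector space structure
  -- is assumed here and supplied afterwards from the exponent condition.
  have aux [Module (ZMod p) M] : ∃ f : M →+ ZMod p, f x ≠ 0 := by
    by_contra! h
    exact hx ((Module.forall_dual_apply_eq_zero_iff (ZMod p) x).1 fun f => h f.toAddMonoidHom)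
  exact @aux (AddCommGroup.zmodModule hM)

/-- A finite commutative group whose order is divisible by the prime `p` maps nontrivially to
`ZMod p`. -/
theorem exists_hom_zmod_ne_one {A : Type*} [CommGroup A] [Finite A] {p : ℕ} (hp : p.Prime)
    (hA : p ∣ Nat.card A) : ∃ (φ : A →* Multiplicative (ZMod p)) (a : A), φ a ≠ 1 := by
  have : Fact p.Prime := ⟨hp⟩
  let R : AddSubgroup (Additive A) := (nsmulAddMonoidHom (α := Additive A) p).range
  -- If every element were a `p`-th power, the `p`-th power map would be injective by finiteness,
  -- but it kills an element of order `p`, which exists by Cauchy's theorem.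
  have hR : R ≠ ⊤ := by
    intro h
    have hs : Function.Surjective (nsmulAddMonoidHom (α := Additive A) p) :=
      AddMonoidHom.range_eq_top.1 h
    have hi := Finite.injective_iff_surjective.2 hs
    obtain ⟨x, hx⟩ := exists_prime_orderOf_dvd_card' (G := A) p hA
    have h1 : (nsmulAddMonoidHom (α := Additive A) p) (Additive.ofMul x) =
        (nsmulAddMonoidHom (α := Additive A) p) 0 := by
      simp only [nsmulAddMonoidHom_apply, smul_zero]
      rw [← ofMul_pow, ← hx, pow_orderOf_eq_one, ofMul_one]
    have h2 : x = 1 := by simpa using hi h1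
    rw [h2, orderOf_one] at hx
    exact hp.one_lt.ne hx
  obtain ⟨x, hx⟩ : ∃ x : Additive A, x ∉ R := by
    by_contra! h
    exact hR ((AddSubgroup.eq_top_iff' R).2 h)
  have hx' : (QuotientAddGroup.mk x : Additive A ⧸ R) ≠ 0 := by
    rwa [Ne, QuotientAddGroup.eq_zero_iff]
  have hR' (y : Additive A ⧸ R) : p • y = 0 := by
    obtain ⟨z, rfl⟩ := QuotientAddGroup.mk_surjective y
    rw [← QuotientAddGroup.mk_nsmul, QuotientAddGroup.eq_zero_iff]
    exact ⟨z, rfl⟩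
  obtain ⟨f, hf⟩ := exists_addHom_zmod_ne_zero hR' hx'
  exact ⟨(f.comp (QuotientAddGroup.mk' R)).toMultiplicativeRight, x.toMul, hf⟩

/-- In a finite group whose order is divisible by the prime `p`, the cyclic group of order `p`
embeds. -/
theorem exists_zmod_hom_injective {H : Type*} [Group H] [Finite H] {p : ℕ} (hp : p.Prime)
    (hH : p ∣ Nat.card H) :
    ∃ ψ : Multiplicative (ZMod p) →* H, Function.Injective ψ := by
  have : Fact p.Prime := ⟨hp⟩
  obtain ⟨x, hx⟩ := exists_prime_orderOf_dvd_card' (G := H) p hH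
  have hc : Nat.card (Subgroup.zpowers x) = p := by rw [Nat.card_zpowers, hx]
  let e : Multiplicative (ZMod p) ≃* Subgroup.zpowers x :=
    mulEquivOfPrimeCardEq (p := p) (by simp) hc
  exact ⟨(Subgroup.zpowers x).subtype.comp e.toMonoidHom,
    Subtype.val_injective.comp e.injective⟩

/-- A finite solvable group `G` is representable on a finite graph if and only if the orders of
the abelianization of `G` and of the automorphism group of the graph have a common prime factor. -/
theorem representable_iff_common_prime (G : Type*) [Group G] [Finite G] [Group.IsSolvable G]
    (V : Type*) [Finite V] (X : SimpleGraph V) :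
    Representable G X ↔
      ∃ p : ℕ, p.Prime ∧ p ∣ Nat.card (G ⧸ commutator G) ∧ p ∣ Nat.card (X ≃g X) := by
  have : Finite (X ≃g X) := DFunLike.finite _
  constructor
  · rintro ⟨ρ, g, hg⟩
    have : Nontrivial ρ.range :=
      ⟨⟨ρ g, ⟨g, rfl⟩⟩, 1, fun h => hg (congrArg Subtype.val h)⟩
    have : Group.IsSolvable ρ.range :=
      Group.isSolvable_of_surjective ρ.rangeRestrict_surjective
    have hlt := Group.IsSolvable.commutator_lt_top_of_nontrivial ρ.range
    have hne : Nat.card (Abelianization ρ.range) ≠ 1 := by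
      intro h
      have h' : (commutator ρ.range).index = 1 := h
      exact hlt.ne (Subgroup.index_eq_one.1 h')
    -- The witness is the least prime factor of the order of the abelianization of the image.
    refine ⟨_, Nat.minFac_prime hne, (Nat.minFac_dvd _).trans ?_, (Nat.minFac_dvd _).trans ?_⟩
    · refine Subgroup.card_dvd_of_surjective (Abelianization.map ρ.rangeRestrict) ?_
      intro x
      obtain ⟨y, rfl⟩ := QuotientGroup.mk_surjective x
      obtain ⟨z, rfl⟩ := ρ.rangeRestrict_surjective y
      exact ⟨Abelianization.of z, Abelianization.map_of _ _⟩
    · exact (Subgroup.index_dvd_card (commutator ρ.range)).trans (Subgroup.card_subgroup_dvd_card _)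
  · rintro ⟨p, hp, hG, hX⟩
    obtain ⟨φ, a, ha⟩ := exists_hom_zmod_ne_one (A := Abelianization G) hp hG
    obtain ⟨ψ, hψ⟩ := exists_zmod_hom_injective hp hX
    obtain ⟨g, rfl⟩ := QuotientGroup.mk_surjective a
    refine ⟨(ψ.comp φ).comp Abelianization.of, g, fun h => ha ?_⟩
    exact hψ (h.trans ψ.map_one.symm)

/-! ### A language of bounded loops, compiled to random access machines -/

namespace OracleRAM

@[simp] theorem State.setReg_reg (s : State) (x v y : ℕ) :
    (s.setReg x v).reg y = if y = x then v else s.reg y := by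
  simp [State.setReg, Function.update_apply]

@[simp] theorem State.setReg_mem (s : State) (x v : ℕ) : (s.setReg x v).mem = s.mem := rfl

@[simp] theorem State.setMem_reg (s : State) (a i v : ℕ) : (s.setMem a i v).reg = s.reg := rfl

@[simp] theorem State.setMem_mem (s : State) (a i v b j : ℕ) :
    (s.setMem a i v).mem b j = if b = a ∧ j = i then v else s.mem b j := by
  simp only [State.setMem, Function.update_apply]
  split_ifs <;> simp_all

/-- Expressions: constants, variables, sums, truncated differences and memory cells. -/
inductive Expr : Type
  | lit (c : ℕ)
  | var (x : ℕ)
  | add (e f : Expr)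
  | sub (e f : Expr)
  | load (a : ℕ) (e : Expr)

namespace Expr

/-- The value of an expression in a state. -/
def eval (s : State) : Expr → ℕ
  | lit c => c
  | var x => s.reg x
  | add e f => e.eval s + f.eval s
  | sub e f => e.eval s - f.eval s
  | load a e => s.mem a (e.eval s)

/-- The number of steps that the evaluation of an expression takes. -/
def time : Expr → ℕ
  | lit _ => 1
  | var _ => 2
  | add e f => e.time + f.time + 1
  | sub e f => e.time + f.time + 1
  | load _ e => e.time + 1

/-- A program that leaves the value of an expression in the auxiliary register `2 * d + 1` and
does not change the auxiliary registers before it. -/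
def compile : Expr → ℕ → Prog
  | lit c, d => .const (2 * d + 1) c
  | var x, d => .seq (.const (2 * d + 1) 0) (.add (2 * d + 1) (2 * x) (2 * d + 1))
  | add e f, d => .seq (.seq (e.compile d) (f.compile (d + 1)))
      (.add (2 * d + 1) (2 * d + 1) (2 * (d + 1) + 1))
  | sub e f, d => .seq (.seq (e.compile d) (f.compile (d + 1)))
      (.sub (2 * d + 1) (2 * d + 1) (2 * (d + 1) + 1))
  | load a e, d => .seq (e.compile d) (.load (2 * d + 1) a (2 * d + 1))

end Expr

/-- The machine state `s` represents the state `h`: the variable `x` is kept in the register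
`2 * x`. Odd registers are auxiliary. -/
structure Sim (h s : State) : Prop where
  mem : s.mem = h.mem
  reg : ∀ x, s.reg (2 * x) = h.reg x

theorem Sim.setOdd {h s : State} (hs : Sim h s) (d v : ℕ) : Sim h (s.setReg (2 * d + 1) v) where
  mem := hs.mem
  reg x := by
    rw [State.setReg_reg, if_neg (by omega), hs.reg]

theorem Sim.setEven {h s : State} (hs : Sim h s) (x v : ℕ) :
    Sim (h.setReg x v) (s.setReg (2 * x) v) where
  mem := hs.mem
  reg y := by
    simp only [State.setReg_reg, hs.reg, mul_eq_mul_left_iff]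
    simp

/-- The odd registers behave as a stack. The second operand is evaluated one level higher, and the
last clause guarantees that the first operand survives this. -/
theorem Expr.exec (O : Set Word) (e : Expr) (d : ℕ) {h s : State} (hs : Sim h s) :
    ∃ s', Exec O (e.compile d) s e.time s' ∧ Sim h s' ∧ s'.reg (2 * d + 1) = e.eval h ∧
      ∀ j < d, s'.reg (2 * j + 1) = s.reg (2 * j + 1) := by
  induction e generalizing d s with
  | lit c =>
    refine ⟨_, .const _ _ _, hs.setOdd _ _, by simp [Expr.eval], fun j hj => ?_⟩
    rw [State.setReg_reg, if_neg (by omega)]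
  | var x =>
    refine ⟨_, .seq (.const _ _ _) (.add _ _ _ _), (hs.setOdd _ _).setOdd _ _, ?_, fun j hj => ?_⟩
    · have h2 : 2 * x ≠ 2 * d + 1 := by omega
      simp [Expr.eval, h2, hs.reg]
    · rw [State.setReg_reg, if_neg (by omega), State.setReg_reg, if_neg (by omega)]
  | add e f ihe ihf =>
    obtain ⟨s₁, e₁, h₁, v₁, f₁⟩ := ihe d hs
    obtain ⟨s₂, e₂, h₂, v₂, f₂⟩ := ihf (d + 1) h₁
    refine ⟨_, .seq (.seq e₁ e₂) (.add _ _ _ _), h₂.setOdd _ _, ?_, fun j hj => ?_⟩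
    · simp [Expr.eval, v₂, f₂ d (by omega), v₁]
    · rw [State.setReg_reg, if_neg (by omega), f₂ j (by omega), f₁ j hj]
  | sub e f ihe ihf =>
    obtain ⟨s₁, e₁, h₁, v₁, f₁⟩ := ihe d hs
    obtain ⟨s₂, e₂, h₂, v₂, f₂⟩ := ihf (d + 1) h₁
    refine ⟨_, .seq (.seq e₁ e₂) (.sub _ _ _ _), h₂.setOdd _ _, ?_, fun j hj => ?_⟩
    · simp [Expr.eval, v₂, f₂ d (by omega), v₁]
    · rw [State.setReg_reg, if_neg (by omega), f₂ j (by omega), f₁ j hj]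
  | load a e ihe =>
    obtain ⟨s₁, e₁, h₁, v₁, f₁⟩ := ihe d hs
    refine ⟨_, .seq e₁ (.load _ _ _ _), h₁.setOdd _ _, ?_, fun j hj => ?_⟩
    · simp [Expr.eval, v₁, h₁.mem]
    · rw [State.setReg_reg, if_neg (by omega), f₁ j hj]

/-- Commands. The loop `loop x y P` runs `P` with `x = 0, 1, …, y - 1`. -/
inductive Cmd : Type
  | set (x : ℕ) (e : Expr)
  | store (a : ℕ) (i e : Expr)
  | query (x a : ℕ) (e : Expr)
  | seq (P Q : Cmd)
  | loop (x y : ℕ) (P : Cmd)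

/-- Apply `f 0`, …, `f (b - 1)` in this order. -/
def iterate (f : ℕ → State → State) : ℕ → State → State
  | 0, s => s
  | b + 1, s => f b (iterate f b s)

namespace Cmd

open Classical in
/-- The effect of a command. -/
noncomputable def eval (O : Set Word) : Cmd → State → State
  | set x e, s => s.setReg x (e.eval s)
  | store a i e, s => s.setMem a (i.eval s) (e.eval s)
  | query x a e, s => s.setReg x (if s.word a (e.eval s) ∈ O then 1 else 0)
  | seq P Q, s => Q.eval O (P.eval O s)
  | loop x y P, s => iterate (fun k s' => P.eval O (s'.setReg x k)) (s.reg y) s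

/-- A bound on the number of steps that a command takes. -/
noncomputable def cost (O : Set Word) : Cmd → State → ℕ
  | set _ e, _ => e.time + 2
  | store _ i e, _ => i.time + e.time + 1
  | query _ a e, s => e.time + 1 + wordSize (s.word a (e.eval s))
  | seq P Q, s => P.cost O s + Q.cost O (P.eval O s)
  | loop x y P, s => 4 + ∑ k ∈ Finset.range (s.reg y),
      (6 + P.cost O ((iterate (fun k s' => P.eval O (s'.setReg x k)) k s).setReg x k))

/-- The program for a command; it may use the auxiliary registers from `2 * d + 1` on. -/
def compile : Cmd → ℕ → Prog
  | set x e, d => .seq (e.compile d)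
      (.seq (.const (2 * (d + 1) + 1) 0) (.add (2 * x) (2 * d + 1) (2 * (d + 1) + 1)))
  | store a i e, d => .seq (.seq (i.compile d) (e.compile (d + 1)))
      (.store a (2 * d + 1) (2 * (d + 1) + 1))
  | query x a e, d => .seq (e.compile d) (.query (2 * x) a (2 * d + 1))
  | seq P Q, d => .seq (P.compile d) (Q.compile d)
  | loop x y P, d => .seq (.seq ((Expr.var y).compile d) (.const (2 * (d + 1) + 1) 0))
      (.loop (2 * d + 1) (.seq (.seq (.seq (.const (2 * (d + 2) + 1) 0)
        (.add (2 * x) (2 * (d + 1) + 1) (2 * (d + 2) + 1))) (P.compile (d + 2)))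
        (.seq (.seq (.const (2 * (d + 2) + 1) 1)
          (.add (2 * (d + 1) + 1) (2 * (d + 1) + 1) (2 * (d + 2) + 1)))
          (.sub (2 * d + 1) (2 * d + 1) (2 * (d + 2) + 1)))))

/-- In a loop, level `d` holds the number of remaining rounds and level `d + 1` the index of the
current round. The body is compiled from level `d + 2` on and cannot disturb them, whatever it does
to the variables `x` and `y`. -/
theorem exec (O : Set Word) (c : Cmd) (d : ℕ) {h s : State} (hs : Sim h s) :
    ∃ t s', Exec O (c.compile d) s t s' ∧ t ≤ c.cost O h ∧ Sim (c.eval O h) s' ∧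
      ∀ j < d, s'.reg (2 * j + 1) = s.reg (2 * j + 1) := by
  induction c generalizing d h s with
  | set x e =>
    obtain ⟨s₁, e₁, h₁, v₁, f₁⟩ := e.exec O d hs
    refine ⟨_, _, .seq e₁ (.seq (.const _ _ _) (.add _ _ _ _)), le_rfl, ?_, fun j hj => ?_⟩
    · have h₂ := (h₁.setOdd (d + 1) 0).setEven x (e.eval h)
      simpa [v₁, eval] using h₂
    · rw [State.setReg_reg, if_neg (by omega), State.setReg_reg, if_neg (by omega), f₁ j hj]
  | store a i e =>
    obtain ⟨s₁, e₁, h₁, v₁, f₁⟩ := i.exec O d hs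
    obtain ⟨s₂, e₂, h₂, v₂, f₂⟩ := e.exec O (d + 1) h₁
    refine ⟨_, _, .seq (.seq e₁ e₂) (.store _ _ _ _), le_rfl, ?_, fun j hj => ?_⟩
    · rw [v₂, f₂ d (by omega), v₁]
      exact ⟨by simp [eval, State.setMem, h₂.mem], h₂.reg⟩
    · rw [State.setMem_reg, f₂ j (by omega), f₁ j hj]
  | query x a e =>
    obtain ⟨s₁, e₁, h₁, v₁, f₁⟩ := e.exec O d hs
    have hw : s₁.word a (s₁.reg (2 * d + 1)) = h.word a (e.eval h) := by
      simp [State.word, v₁, h₁.mem]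
    by_cases hO : h.word a (e.eval h) ∈ O
    · refine ⟨_, _, .seq e₁ (.query_yes _ _ _ _ (hw ▸ hO)), ?_, ?_, fun j hj => ?_⟩
      · simp [cost, hw, add_assoc]
      · simpa [eval, hO] using h₁.setEven x 1
      · rw [State.setReg_reg, if_neg (by omega), f₁ j hj]
    · refine ⟨_, _, .seq e₁ (.query_no _ _ _ _ (hw ▸ hO)), ?_, ?_, fun j hj => ?_⟩
      · simp [cost, hw, add_assoc]
      · simpa [eval, hO] using h₁.setEven x 0
      · rw [State.setReg_reg, if_neg (by omega), f₁ j hj]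
  | seq P Q ihP ihQ =>
    obtain ⟨t₁, s₁, e₁, c₁, h₁, f₁⟩ := ihP d hs
    obtain ⟨t₂, s₂, e₂, c₂, h₂, f₂⟩ := ihQ d h₁
    exact ⟨_, _, .seq e₁ e₂, Nat.add_le_add c₁ c₂, h₂, fun j hj => (f₂ j hj).trans (f₁ j hj)⟩
  | loop x y P ih =>
    set f : ℕ → State → State := fun k s' => P.eval O (s'.setReg x k) with hf
    set g : ℕ → ℕ := fun k => 6 + P.cost O ((iterate f k h).setReg x k) with hg
    -- Induction on the number `r` of remaining rounds, after `k` rounds have been completed.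
    have key : ∀ (r k : ℕ) (s : State), Sim (iterate f k h) s → s.reg (2 * d + 1) = r →
        s.reg (2 * (d + 1) + 1) = k → ∃ t s', Exec O (.loop (2 * d + 1)
          (.seq (.seq (.seq (.const (2 * (d + 2) + 1) 0)
          (.add (2 * x) (2 * (d + 1) + 1) (2 * (d + 2) + 1))) (P.compile (d + 2)))
          (.seq (.seq (.const (2 * (d + 2) + 1) 1)
          (.add (2 * (d + 1) + 1) (2 * (d + 1) + 1) (2 * (d + 2) + 1)))
          (.sub (2 * d + 1) (2 * d + 1) (2 * (d + 2) + 1))))) s t s' ∧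
          t ≤ 1 + ∑ l ∈ Finset.range r, g (k + l) ∧ Sim (iterate f (k + r) h) s' ∧
          ∀ j < d, s'.reg (2 * j + 1) = s.reg (2 * j + 1) := by
      intro r
      induction r with
      | zero =>
        intro k s hs hr hk
        exact ⟨_, _, .loop_done hr, by simp, hs, fun _ _ => rfl⟩
      | succ r ihr =>
        intro k s hs hr hk
        have hx := (hs.setOdd (d + 2) 0).setEven x k
        obtain ⟨t₁, s₁, e₁, c₁, h₁, f₁⟩ := ih (d + 2) hx
        have r₁ : s₁.reg (2 * d + 1) = r + 1 := by
          rw [f₁ d (by omega), State.setReg_reg, if_neg (by omega), State.setReg_reg,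
            if_neg (by omega), hr]
        have r₂ : s₁.reg (2 * (d + 1) + 1) = k := by
          rw [f₁ (d + 1) (by omega), State.setReg_reg, if_neg (by omega), State.setReg_reg,
            if_neg (by omega), hk]
        have h₂ := ((h₁.setOdd (d + 2) 1).setOdd (d + 1) (k + 1)).setOdd d r
        obtain ⟨t₂, s₂, e₂, c₂, h₂', f₂⟩ := ihr (k + 1) _ h₂ (by simp) (by simp)
        have e₁' := Exec.seq (.seq (.const s (2 * (d + 2) + 1) 0)
          (.add _ (2 * x) (2 * (d + 1) + 1) (2 * (d + 2) + 1))) (by simpa [hk] using e₁)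
        have e₂' := Exec.seq (.seq (.const (O := O) s₁ (2 * (d + 2) + 1) 1)
          (.add _ (2 * (d + 1) + 1) (2 * (d + 1) + 1) (2 * (d + 2) + 1)))
          (.sub _ (2 * d + 1) (2 * d + 1) (2 * (d + 2) + 1))
        refine ⟨_, s₂, .loop_step (by rw [hr]; simp) (.seq e₁' e₂')
          (by simpa [r₁, r₂] using e₂), ?_, ?_, ?_⟩
        -- The 6 steps of overhead in a round are the test, two assignments that set `x`, and three
        -- that update the two counters.
        · rw [Finset.sum_range_succ']
          have h3 : ∀ l, g (k + 1 + l) = g (k + (l + 1)) := fun l => by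
            rw [add_assoc, add_comm 1 l]
          simp only [h3] at c₂
          simp only [add_zero, hg] at c₂ ⊢
          omega
        · rwa [add_assoc, add_comm 1 r] at h₂'
        · intro j hj
          rw [f₂ j hj, State.setReg_reg, if_neg (by omega), State.setReg_reg, if_neg (by omega),
            State.setReg_reg, if_neg (by omega), f₁ j (by omega), State.setReg_reg,
            if_neg (by omega), State.setReg_reg, if_neg (by omega)]
    obtain ⟨s₁, e₁, h₁, v₁, f₁⟩ := (Expr.var y).exec O d hs
    have h₂ := h₁.setOdd (d + 1) 0
    obtain ⟨t₂, s₂, e₂, c₂, h₂', f₂⟩ := key (h.reg y) 0 _ h₂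
      (by rw [State.setReg_reg, if_neg (by omega), v₁]; rfl) (by simp)
    refine ⟨_, _, .seq (.seq e₁ (.const _ _ _)) e₂, ?_, ?_, fun j hj => ?_⟩
    · simp only [zero_add] at c₂
      simp only [cost, Expr.time]
      simp only [hg, hf] at c₂
      omega
    · simpa [eval] using h₂'
    · rw [f₂ j hj, State.setReg_reg, if_neg (by omega), f₁ j hj]

end Cmd

end OracleRAM

/-! ### Frames, loop invariants and polynomial time bounds -/

namespace OracleRAM

namespace Cmd

/-- Whether a command may assign to the variable `r`. -/
def writesReg : Cmd → ℕ → Bool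
  | set x _, r => r == x
  | store _ _ _, _ => false
  | query x _ _, r => r == x
  | seq P Q, r => P.writesReg r || Q.writesReg r
  | loop x _ P, r => r == x || P.writesReg r

/-- Whether a command may assign to a cell of the memory bank `b`. -/
def writesMem : Cmd → ℕ → Bool
  | set _ _, _ => false
  | store a _ _, b => b == a
  | query _ _ _, _ => false
  | seq P Q, b => P.writesMem b || Q.writesMem b
  | loop _ _ P, b => P.writesMem b

/-- The states `s` and `s'` differ at most in what the command `c` writes. -/
structure Frame (c : Cmd) (s s' : State) : Prop where
  reg : ∀ r, c.writesReg r = false → s'.reg r = s.reg r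
  mem : ∀ b, c.writesMem b = false → s'.mem b = s.mem b

theorem Frame.refl (c : Cmd) (s : State) : Frame c s s := ⟨fun _ _ => rfl, fun _ _ => rfl⟩

theorem Frame.loop_step {O : Set Word} {x y : ℕ} {P : Cmd} {s s' : State} {k : ℕ}
    (hP : ∀ s, Frame P s (P.eval O s)) (h : Frame (loop x y P) s s') :
    Frame (loop x y P) s (P.eval O (s'.setReg x k)) where
  reg r hr := by
    have hr' := hr
    simp only [writesReg, Bool.or_eq_false_iff, beq_eq_false_iff_ne] at hr'
    rw [(hP _).reg r hr'.2, State.setReg_reg, if_neg hr'.1, h.reg r hr]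
  mem b hb := by rw [(hP _).mem b hb, State.setReg_mem, h.mem b hb]

/-- Since `writesReg` and `writesMem` are computed from the syntax, that a concrete command leaves a
register or a bank alone is afterwards proved by `rfl`. -/
theorem frame_eval (O : Set Word) (c : Cmd) (s : State) : Frame c s (c.eval O s) := by
  induction c generalizing s with
  | set x e => exact ⟨fun r hr => by simp_all [eval, writesReg], fun _ _ => rfl⟩
  | store a i e =>
    refine ⟨fun _ _ => rfl, fun b hb => funext fun j => ?_⟩
    simp_all [eval, writesMem]
  | query x a e => exact ⟨fun r hr => by simp_all [eval, writesReg], fun _ _ => rfl⟩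
  | seq P Q ihP ihQ =>
    refine ⟨fun r hr => ?_, fun b hb => ?_⟩
    · simp only [writesReg, Bool.or_eq_false_iff] at hr
      rw [eval, (ihQ _).reg r hr.2, (ihP _).reg r hr.1]
    · simp only [writesMem, Bool.or_eq_false_iff] at hb
      rw [eval, (ihQ _).mem b hb.2, (ihP _).mem b hb.1]
  | loop x y P ih =>
    rw [eval]
    generalize s.reg y = b
    induction b with
    | zero => exact Frame.refl _ _
    | succ b ihb => exact Frame.loop_step ih ihb

theorem frame_iterate (O : Set Word) (x y : ℕ) (P : Cmd) (s : State) (k : ℕ) :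
    Frame (loop x y P) s (iterate (fun k s' => P.eval O (s'.setReg x k)) k s) := by
  induction k with
  | zero => exact Frame.refl _ _
  | succ k ih => exact Frame.loop_step (frame_eval O P) ih

/-- Loop invariants. -/
theorem eval_loop_induction {O : Set Word} {x y : ℕ} {P : Cmd} {s : State}
    (I : ℕ → State → Prop) (h₀ : I 0 s)
    (step : ∀ k < s.reg y, ∀ s', Frame (loop x y P) s s' → I k s' →
      I (k + 1) (P.eval O (s'.setReg x k))) :
    I (s.reg y) ((loop x y P).eval O s) := by
  -- The frame condition comes for free in every round, so an invariant only has to mention what the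
  -- body changes.
  have key : ∀ k ≤ s.reg y, I k (iterate (fun k s' => P.eval O (s'.setReg x k)) k s) := by
    intro k
    induction k with
    | zero => exact fun _ => h₀
    | succ k ih => exact fun hk => step k hk _ (frame_iterate O x y P s k) (ih (by omega))
  exact key _ le_rfl

/-- The variables that bound loops. -/
def isSize (x : ℕ) : Bool := (1 ≤ x) && (x ≤ 5)

/-- All loops are bounded by size variables, which are never changed. -/
def tame : Cmd → Bool
  | set x _ => !isSize x
  | store _ _ _ => true
  | query x _ _ => !isSize x
  | seq P Q => P.tame && Q.tame
  | loop x y P => !isSize x && isSize y && P.tame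

theorem tame.writesReg_eq_false {c : Cmd} (hc : c.tame = true) {r : ℕ} (hr : isSize r = true) :
    c.writesReg r = false := by
  induction c with
  | set x e | query x a e =>
    simp only [writesReg, beq_eq_false_iff_ne]
    rintro rfl
    simp [tame, hr] at hc
  | store a i e => rfl
  | seq P Q ihP ihQ =>
    simp only [tame, Bool.and_eq_true] at hc
    simp [writesReg, ihP hc.1, ihQ hc.2]
  | loop x y P ih =>
    simp only [tame, Bool.and_eq_true] at hc
    simp only [writesReg, Bool.or_eq_false_iff, beq_eq_false_iff_ne, ih hc.2, and_true]
    rintro rfl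
    simp [hr] at hc

/-- All words that are submitted to the oracle have bit length at most `B`. -/
def QueryBound (O : Set Word) (B : ℕ) : Cmd → State → Prop
  | set _ _, _ => True
  | store _ _ _, _ => True
  | query _ a e, s => wordSize (s.word a (e.eval s)) ≤ B
  | seq P Q, s => P.QueryBound O B s ∧ Q.QueryBound O B (P.eval O s)
  | loop x y P, s => ∀ k < s.reg y,
      P.QueryBound O B ((iterate (fun k s' => P.eval O (s'.setReg x k)) k s).setReg x k)

theorem QueryBound.mono {O : Set Word} {B B' : ℕ} {c : Cmd} {s : State}
    (h : c.QueryBound O B s) (hB : B ≤ B') : c.QueryBound O B' s := by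
  induction c generalizing s with
  | set x e | store a i e => trivial
  | query x a e => exact Nat.le_trans h hB
  | seq P Q ihP ihQ => exact ⟨ihP h.1, ihQ h.2⟩
  | loop x y P ih => exact fun k hk => ih (h k hk)

/-- The command does not use the oracle. -/
def queryFree : Cmd → Bool
  | set _ _ => true
  | store _ _ _ => true
  | query _ _ _ => false
  | seq P Q => P.queryFree && Q.queryFree
  | loop _ _ P => P.queryFree

theorem queryFree.queryBound {O : Set Word} {B : ℕ} {c : Cmd} (hc : c.queryFree = true)
    (s : State) : c.QueryBound O B s := by
  induction c generalizing s with
  | set x e | store a i e => trivial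
  | query x a e => simp [queryFree] at hc
  | seq P Q ihP ihQ =>
    simp only [queryFree, Bool.and_eq_true] at hc
    exact ⟨ihP hc.1 s, ihQ hc.2 _⟩
  | loop x y P ih => exact fun k _ => ih hc _

theorem queryBound_loop {O : Set Word} {B x y : ℕ} {P : Cmd} {s : State}
    (h : ∀ k < s.reg y, ∀ s', Frame (loop x y P) s s' → P.QueryBound O B (s'.setReg x k)) :
    (loop x y P).QueryBound O B s :=
  fun k hk => h k hk _ (frame_iterate O x y P s k)

/-- A polynomial bound on the running time, given a polynomial bound `q` on the queries. -/
noncomputable def timeBound (q : Polynomial ℕ) : Cmd → Polynomial ℕ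
  | set _ e => .C (e.time + 2)
  | store _ i e => .C (i.time + e.time + 1)
  | query _ _ e => .C (e.time + 1) + q
  | seq P Q => P.timeBound q + Q.timeBound q
  | loop _ _ P => .C 4 + (.X + .C 4) * (.C 6 + P.timeBound q)

/-- Tameness keeps the loop bounds constant during the run, so each loop multiplies the cost of its
body by at most `N + 4`. The nesting depth is fixed by the program, hence the bound is a polynomial
in `N`. -/
theorem cost_le_timeBound {O : Set Word} {q : Polynomial ℕ} {N : ℕ} {c : Cmd}
    (hc : c.tame = true) {s : State} (hs : ∀ r, isSize r = true → s.reg r ≤ N + 4)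
    (hq : c.QueryBound O (q.eval N) s) : c.cost O s ≤ (c.timeBound q).eval N := by
  induction c generalizing s with
  | set x e | store a i e => simp [cost, timeBound]
  | query x a e =>
    simp only [cost, timeBound, Polynomial.eval_add, Polynomial.eval_C]
    exact Nat.add_le_add_left hq _
  | seq P Q ihP ihQ =>
    simp only [tame, Bool.and_eq_true] at hc
    simp only [cost, timeBound, Polynomial.eval_add]
    refine Nat.add_le_add (ihP hc.1 hs hq.1) (ihQ hc.2 (fun r hr => ?_) hq.2)
    rw [(frame_eval O P s).reg r (tame.writesReg_eq_false hc.1 hr)]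
    exact hs r hr
  | loop x y P ih =>
    have hl := hc
    simp only [tame, Bool.and_eq_true] at hc
    simp only [cost, timeBound, Polynomial.eval_add, Polynomial.eval_mul, Polynomial.eval_C,
      Polynomial.eval_X]
    refine Nat.add_le_add_left ?_ 4
    calc _ ≤ ∑ k ∈ Finset.range (s.reg y), (6 + (P.timeBound q).eval N) := by
          refine Finset.sum_le_sum fun k hk => Nat.add_le_add_left (ih hc.2 (fun r hr => ?_)
            (hq k (Finset.mem_range.1 hk))) 6
          have hw := tame.writesReg_eq_false hl hr
          have hw' := hw
          simp only [writesReg, Bool.or_eq_false_iff, beq_eq_false_iff_ne] at hw'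
          rw [State.setReg_reg, if_neg hw'.1, (frame_iterate O x y P s k).reg r hw]
          exact hs r hr
      _ = s.reg y * (6 + (P.timeBound q).eval N) := by simp
      _ ≤ _ := Nat.mul_le_mul_right _ (hs y hc.1.2)

/-! ### Commands that append words to a memory bank -/

/-- The command appends the word `L` to the word in the memory bank `a` whose length is the value
of the variable `p`. -/
def Emits (O : Set Word) (c : Cmd) (a p : ℕ) (s : State) (L : Word) : Prop :=
  (c.eval O s).word a ((c.eval O s).reg p) = s.word a (s.reg p) ++ L

/-- Append the value of an expression. -/
def emit (a p : ℕ) (e : Expr) : Cmd :=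
  seq (store a (.var p) e) (set p (.add (.var p) (.lit 1)))

theorem emits_emit (O : Set Word) (a p : ℕ) (e : Expr) (s : State) :
    Emits O (emit a p e) a p s [e.eval s] := by
  simp only [Emits, emit, eval, State.word, Expr.eval, State.setReg_reg, if_true,
    State.setReg_mem, State.setMem_reg, List.range_succ, List.map_append, List.map_cons,
    List.map_nil, State.setMem_mem, and_self]
  congr 1
  -- The new letter goes to the first free cell, so the cells of the old word are unchanged.
  refine List.map_congr_left fun j hj => ?_
  rw [State.setMem_mem, if_neg]
  have := List.mem_range.1 hj
  omega

theorem Emits.seq {O : Set Word} {P Q : Cmd} {a p : ℕ} {s : State} {L M : Word}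
    (hP : Emits O P a p s L) (hQ : Emits O Q a p (P.eval O s) M) :
    Emits O (seq P Q) a p s (L ++ M) := by
  simp only [Emits, eval] at *
  rw [hQ, hP, List.append_assoc]

theorem Emits.loop {O : Set Word} {x y : ℕ} {P : Cmd} {a p : ℕ} {s : State} {L : ℕ → Word}
    (hp : p ≠ x) (h : ∀ k < s.reg y, ∀ s', Frame (loop x y P) s s' →
      Emits O P a p (s'.setReg x k) (L k)) :
    Emits O (loop x y P) a p s ((List.range (s.reg y)).flatMap L) := by
  refine eval_loop_induction (x := x) (y := y) (P := P) (I := fun k s' => s'.word a (s'.reg p) =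
    s.word a (s.reg p) ++ (List.range k).flatMap L) (by simp) fun k hk s' hf ih => ?_
  have := h k hk s' hf
  simp only [Emits] at this
  rw [this, List.range_succ, List.flatMap_append, ← List.append_assoc, ← ih]
  simp [State.word, hp]

end Cmd

/-! ### Truth values by truncated subtraction -/

namespace Expr

/-- The truth value of `e = f`. -/
def eq (e f : Expr) : Expr := .sub (.lit 1) (.add (.sub e f) (.sub f e))

/-- The truth value of `e ≤ f`. -/
def le (e f : Expr) : Expr := .sub (.lit 1) (.sub e f)

/-- Negation. -/
def not (e : Expr) : Expr := .sub (.lit 1) e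

/-- Conjunction. -/
def and (e f : Expr) : Expr := .not (.add (.not e) (.not f))

/-- Disjunction. -/
def or (e f : Expr) : Expr := .not (.not (.add e f))

variable (s : State) (e f : Expr)

theorem eval_eq : (eq e f).eval s = if e.eval s = f.eval s then 1 else 0 := by
  simp only [eq, eval]; split_ifs <;> omega

theorem eval_le : (le e f).eval s = if e.eval s ≤ f.eval s then 1 else 0 := by
  simp only [le, eval]; split_ifs <;> omega

theorem eval_not : (not e).eval s = if e.eval s = 0 then 1 else 0 := by
  simp only [not, eval]; split_ifs <;> omega

theorem eval_and : (and e f).eval s = if e.eval s ≠ 0 ∧ f.eval s ≠ 0 then 1 else 0 := by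
  simp only [and, not, eval]; split_ifs <;> omega

theorem eval_or : (or e f).eval s = if e.eval s ≠ 0 ∨ f.eval s ≠ 0 then 1 else 0 := by
  simp only [or, not, eval]; split_ifs <;> omega

end Expr

end OracleRAM

/-! ### Vertex weights as pendant vertices -/

namespace SimpleGraph

variable {V : Type*}

/-- The graph `X` with `w v` new pendant vertices attached to every vertex `v`. The vertices of `X`
are the pairs `(v, 0)`; pairs that are not needed are isolated vertices. -/
def withPendants (X : SimpleGraph V) (w : V → ℕ) (k : ℕ) : SimpleGraph (V × Fin (k + 1)) where
  Adj p q := ((p.2 : ℕ) = 0 ∧ (q.2 : ℕ) = 0 ∧ X.Adj p.1 q.1) ∨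
    (p.1 = q.1 ∧ ((p.2 : ℕ) = 0 ∨ (q.2 : ℕ) = 0) ∧ 0 < (p.2 : ℕ) + q.2 ∧ (p.2 : ℕ) + q.2 ≤ w p.1)
  symm := ⟨by
    rintro ⟨u, a⟩ ⟨v, b⟩ (⟨ha, hb, h⟩ | ⟨rfl, h, h₁, h₂⟩)
    · exact Or.inl ⟨hb, ha, h.symm⟩
    · exact Or.inr ⟨rfl, h.symm, by simpa [add_comm] using h₁, by simpa [add_comm] using h₂⟩⟩
  loopless := ⟨by
    rintro ⟨u, a⟩ (⟨-, -, h⟩ | ⟨-, h, h₁, -⟩)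
    · exact h.ne rfl
    · simp only [or_self] at h; simp [h] at h₁⟩

variable {X : SimpleGraph V} {w w' : V → ℕ} {k : ℕ}

theorem withPendants_adj_core {u v : V} :
    (X.withPendants w k).Adj (u, 0) (v, 0) ↔ X.Adj u v := by
  simp [withPendants]

/-- A vertex of `X` has at least two pendant neighbours because all weights are at least 2. A pair
`(v, a)` with `a ≠ 0` can only be adjacent to `(v, 0)`. So isomorphisms recognize the vertices of
`X` by their degree. -/
theorem withPendants_core_iff (hw : ∀ v, 2 ≤ w v) (hk : 2 ≤ k) (p : V × Fin (k + 1)) :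
    p.2 = 0 ↔ ∃ q r, q ≠ r ∧ (X.withPendants w k).Adj p q ∧ (X.withPendants w k).Adj p r := by
  obtain ⟨v, a⟩ := p
  constructor
  · rintro rfl
    have h := hw v
    refine ⟨(v, ⟨1, by omega⟩), (v, ⟨2, by omega⟩), by simp, ?_, ?_⟩ <;>
      refine Or.inr ⟨rfl, Or.inl rfl, ?_, ?_⟩ <;> simp <;> omega
  · rintro ⟨⟨u, b⟩, ⟨x, c⟩, hne, h₁, h₂⟩
    by_contra ha
    have ha' : (a : ℕ) ≠ 0 := fun h => ha (Fin.ext h)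
    simp only [withPendants, ha', false_and, false_or] at h₁ h₂
    obtain ⟨rfl, hb, -⟩ := h₁
    obtain ⟨rfl, hc, -⟩ := h₂
    exact hne (by rw [Fin.ext (hb.trans hc.symm)])

/-- The pendant neighbours of `(v, 0)` are the pairs `(v, b)` with `1 ≤ b ≤ w v`; counting them
recovers the weight from the graph. -/
theorem withPendants_ncard (hw : ∀ v, w v ≤ k) (v : V) :
    {q | (X.withPendants w k).Adj (v, 0) q ∧ q.2 ≠ 0}.ncard = w v := by
  have h : {q | (X.withPendants w k).Adj (v, 0) q ∧ q.2 ≠ 0} =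
      (fun b : ℕ => (v, Fin.ofNat (k + 1) b)) '' (Set.Icc 1 (w v)) := by
    ext ⟨u, b⟩
    have hv := hw v
    simp only [withPendants, Set.mem_ofPred_eq, Set.mem_image, Set.mem_Icc, Prod.mk.injEq]
    constructor
    · rintro ⟨⟨-, h, -⟩ | ⟨rfl, -, h₁, h₂⟩, hb⟩
      · exact absurd (Fin.ext h) hb
      · refine ⟨b, ⟨?_, ?_⟩, rfl, by simp⟩
        · exact Nat.pos_of_ne_zero fun h => hb (Fin.ext h)
        · simpa using h₂
    · rintro ⟨c, ⟨hc₁, hc₂⟩, rfl, rfl⟩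
      have hc : c % (k + 1) = c := Nat.mod_eq_of_lt (by omega)
      refine ⟨Or.inr ⟨rfl, Or.inl rfl, ?_, ?_⟩, fun h => ?_⟩
      · simp [hc]; omega
      · simp [hc, hc₂]
      · have := congrArg Fin.val h
        simp [hc] at this
        omega
  rw [h, Set.InjOn.ncard_image, ← Finset.coe_Icc, Set.ncard_coe_finset, Nat.card_Icc]
  · omega
  · intro b hb c hc h
    have hv := hw v
    simp only [Set.mem_Icc] at hb hc
    have := congrArg Fin.val (Prod.mk.inj h).2
    simp only [Fin.val_ofNat] at this
    rwa [Nat.mod_eq_of_lt (by omega), Nat.mod_eq_of_lt (by omega)] at this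

/-- The isomorphisms of weighted graphs are seen by the isomorphisms of the graphs with pendant
vertices. -/
theorem nonempty_iso_withPendants_iff (hw : ∀ v, 2 ≤ w v ∧ w v ≤ k)
    (hw' : ∀ v, 2 ≤ w' v ∧ w' v ≤ k) (hk : 2 ≤ k) :
    Nonempty (X.withPendants w k ≃g X.withPendants w' k) ↔
      ∃ σ : X ≃g X, ∀ v, w' (σ v) = w v := by
  constructor
  · rintro ⟨φ⟩
    -- Having two distinct neighbours is invariant under isomorphisms.
    have core : ∀ p, (φ p).2 = 0 ↔ p.2 = 0 := by
      intro p
      rw [withPendants_core_iff (X := X) (fun v => (hw v).1) hk p,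
        withPendants_core_iff (X := X) (fun v => (hw' v).1) hk (φ p)]
      constructor
      · rintro ⟨q, r, hne, hq, hr⟩
        refine ⟨φ.symm q, φ.symm r, fun h => hne (φ.symm.injective h), ?_, ?_⟩
        · rw [← φ.map_adj_iff]; simpa using hq
        · rw [← φ.map_adj_iff]; simpa using hr
      · rintro ⟨q, r, hne, hq, hr⟩
        exact ⟨φ q, φ r, fun h => hne (φ.injective h), φ.map_adj_iff.2 hq, φ.map_adj_iff.2 hr⟩
    have hφ : ∀ v, φ (v, 0) = ((φ (v, 0)).1, 0) := fun v =>
      Prod.ext rfl ((core (v, 0)).2 rfl)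
    have core' : ∀ p, (φ.symm p).2 = 0 ↔ p.2 = 0 := fun p => by
      rw [← core (φ.symm p)]; simp
    have hφ' : ∀ v, φ.symm (v, 0) = ((φ.symm (v, 0)).1, 0) := fun v =>
      Prod.ext rfl ((core' (v, 0)).2 rfl)
    let σ : X ≃g X :=
      { toFun := fun v => (φ (v, 0)).1
        invFun := fun v => (φ.symm (v, 0)).1
        left_inv := fun v => by
          change (φ.symm ((φ (v, 0)).1, 0)).1 = v
          rw [← hφ]; simp
        right_inv := fun v => by
          change (φ ((φ.symm (v, 0)).1, 0)).1 = v
          rw [← hφ']; simp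
        map_rel_iff' := fun {u v} => by
          change X.Adj (φ (u, 0)).1 (φ (v, 0)).1 ↔ X.Adj u v
          rw [← withPendants_adj_core (w := w') (k := k), ← hφ, ← hφ, φ.map_adj_iff,
            withPendants_adj_core] }
    -- The weights agree because `φ` maps the pendant neighbours of `(v, 0)` onto those of `(σ v,
    -- 0)`.
    refine ⟨σ, fun v => ?_⟩
    rw [← withPendants_ncard (X := X) (fun v => (hw v).2) v,
      ← withPendants_ncard (X := X) (fun v => (hw' v).2) (σ v),
      ← Set.ncard_image_of_injective {q | (X.withPendants w k).Adj (v, 0) q ∧ q.2 ≠ 0} φ.injective]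
    congr 1
    ext q
    change (X.withPendants w' k).Adj ((φ (v, 0)).1, 0) q ∧ q.2 ≠ 0 ↔ _
    rw [← hφ]
    constructor
    · rintro ⟨h₁, h₂⟩
      refine ⟨φ.symm q, ⟨?_, ?_⟩, by simp⟩
      · rw [← φ.map_adj_iff]; simpa using h₁
      · rwa [Ne, core']
    · rintro ⟨r, ⟨h₁, h₂⟩, rfl⟩
      exact ⟨φ.map_adj_iff.2 h₁, by rwa [Ne, core]⟩
  · rintro ⟨σ, hσ⟩
    refine ⟨⟨σ.toEquiv.prodCongr (Equiv.refl _), ?_⟩⟩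
    rintro ⟨u, a⟩ ⟨v, b⟩
    have huv : X.Adj (σ u) (σ v) ↔ X.Adj u v := σ.map_adj_iff
    simp [withPendants, hσ, huv]

/-! ### The stabilizer chain of the automorphism group -/

variable {n : ℕ} (Y : SimpleGraph (Fin n))

/-- The automorphisms that fix the vertices `0, …, i - 1`. -/
def fixing (i : ℕ) : Subgroup (Y ≃g Y) where
  carrier := {σ | ∀ v : Fin n, (v : ℕ) < i → σ v = v}
  mul_mem' {σ τ} hσ hτ v hv := by
    change σ (τ v) = v
    rw [hτ v hv, hσ v hv]
  one_mem' _ _ := rfl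
  inv_mem' {σ} hσ v hv := by
    change σ.symm v = v
    rw [← hσ v hv, σ.symm_apply_apply, hσ v hv]

/-- The orbit of the vertex `i` under the automorphisms that fix all smaller vertices. -/
def basicOrbit (i : Fin n) : Set (Fin n) := {j | ∃ σ ∈ Y.fixing i, σ i = j}

/-- Orbit-stabilizer theorem: the stabilizer of `i` among the automorphisms that fix `0, …, i - 1`
consists of those that fix `0, …, i`. -/
theorem card_fixing (i : Fin n) :
    Nat.card (Y.fixing i) = (Y.basicOrbit i).ncard * Nat.card (Y.fixing (i + 1)) := by
  let _ : MulAction (Y.fixing i) (Fin n) :=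
    { smul := fun σ v => σ.1 v, one_smul := fun _ => rfl, mul_smul := fun _ _ _ => rfl }
  have h₁ : MulAction.orbit (Y.fixing i) i = Y.basicOrbit i := by
    ext j
    constructor
    · rintro ⟨σ, h⟩
      exact ⟨σ.1, σ.2, h⟩
    · rintro ⟨σ, hσ, h⟩
      exact ⟨⟨σ, hσ⟩, h⟩
  have h₂ : Nat.card (MulAction.stabilizer (Y.fixing i) i) = Nat.card (Y.fixing (i + 1)) := by
    refine Nat.card_congr
      { toFun := fun σ => ⟨σ.1.1, fun v hv => ?_⟩
        invFun := fun σ => ⟨⟨σ.1, fun v hv => σ.2 v (by omega)⟩, σ.2 i (by omega)⟩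
        left_inv := fun _ => rfl
        right_inv := fun _ => rfl }
    rcases Nat.lt_succ_iff_lt_or_eq.1 hv with h | h
    · exact σ.1.2 v h
    · rw [Fin.ext h]
      exact σ.2
  rw [← Nat.card_congr (MulAction.orbitProdStabilizerEquivGroup (Y.fixing i) i), Nat.card_prod, h₂,
    ← h₁, Nat.card_coe_set_eq]

/-- The orbit formula telescopes along the chain from the full group, where nothing has to be fixed,
down to the trivial group, where all `n` vertices are. -/
theorem card_aut_eq_prod : Nat.card (Y ≃g Y) = ∏ i : Fin n, (Y.basicOrbit i).ncard := by
  have key : ∀ t ≤ n, Nat.card (Y ≃g Y) =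
      (∏ i ∈ Finset.range t, if h : i < n then (Y.basicOrbit ⟨i, h⟩).ncard else 1) *
        Nat.card (Y.fixing t) := by
    intro t
    induction t with
    | zero =>
      intro _
      have h : Y.fixing 0 = ⊤ := by
        refine (Subgroup.eq_top_iff' _).2 fun σ v hv => ?_
        omega
      rw [h, Subgroup.card_top]
      simp
    | succ t ih =>
      intro ht
      rw [ih (by omega), Finset.prod_range_succ, dif_pos (show t < n by omega), mul_assoc]
      congr 1
      exact Y.card_fixing ⟨t, by omega⟩
  have hn : Y.fixing n = ⊥ := by
    rw [Subgroup.eq_bot_iff_forall]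
    intro σ hσ
    ext v
    exact congrArg Fin.val (hσ v v.2)
  rw [key n le_rfl, hn, Subgroup.card_bot, mul_one, ← Fin.prod_univ_eq_prod_range
    (fun i => if h : i < n then (Y.basicOrbit ⟨i, h⟩).ncard else 1)]
  simp

/-- The weights that mark the vertices `0, …, i - 1` and `j`. -/
def mark (i j v : ℕ) : ℕ := if v = j then i + 3 else if v < i then v + 3 else 2

/-- The weights `v + 3` for `v < i` and `i + 3` are distinct and differ from the background weight
2, so matching weights forces `σ` to fix every `v < i` and to map `i` to `j`. For `j < i` both sides
fail: the weight `j + 3` is missing from the second marking, and `j` is already fixed. -/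
theorem exists_mark_iff (i j : Fin n) :
    (∃ σ : Y ≃g Y, ∀ v : Fin n, mark i j (σ v) = mark i i v) ↔ j ∈ Y.basicOrbit i := by
  constructor
  · rintro ⟨σ, hσ⟩
    refine ⟨σ, fun v hv => ?_, ?_⟩
    · have h := hσ v
      apply Fin.ext
      simp only [mark] at h
      split_ifs at h <;> omega
    · have h := hσ i
      apply Fin.ext
      simp only [mark] at h
      split_ifs at h <;> omega
  · rintro ⟨σ, hσ, rfl⟩
    refine ⟨σ, fun v => ?_⟩
    have hinj : ((σ v : Fin n) : ℕ) = σ i ↔ (v : ℕ) = i := by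
      rw [← Fin.ext_iff, ← Fin.ext_iff]
      exact σ.injective.eq_iff
    simp only [mark, hinj]
    split_ifs with h₁ h₂ h₃ h₄
    · rfl
    -- The vertex `σ v` is less than `i`, hence fixed by `σ`, and injectivity gives `σ v = v`.
    · rw [σ.injective (hσ _ h₂)]
    · exfalso
      have := congrArg Fin.val (σ.injective (hσ _ h₂))
      omega
    · rw [hσ v h₄] at h₂
      exact absurd h₄ h₂
    · rfl

theorem mark_le {i j v : ℕ} (hi : i < n) : 2 ≤ mark i j v ∧ mark i j v ≤ n + 2 := by
  unfold mark
  split_ifs <;> omega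

/-- The graph on which the marked vertices can be recognized, with its vertices numbered. -/
def markedGraph (i j : ℕ) : SimpleGraph (Fin (n * (n + 2 + 1))) :=
  (Y.withPendants (fun v => mark i j v) (n + 2)).comap finProdFinEquiv.symm

theorem nonempty_iso_markedGraph_iff (i j : Fin n) :
    Nonempty (Y.markedGraph i i ≃g Y.markedGraph i j) ↔ j ∈ Y.basicOrbit i := by
  rw [← exists_mark_iff, ← nonempty_iso_withPendants_iff (k := n + 2)
    (w := fun v : Fin n => mark i i v) (w' := fun v : Fin n => mark i j v) (fun v => mark_le i.2) (fun v => mark_le i.2) (by omega)]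
  let e (j : ℕ) : Y.markedGraph i j ≃g Y.withPendants (fun v => mark i j v) (n + 2) :=
    SimpleGraph.Iso.comap finProdFinEquiv.symm _
  exact ⟨fun ⟨f⟩ => ⟨((e i).symm.trans f).trans (e j)⟩,
    fun ⟨f⟩ => ⟨((e i).trans f).trans (e j).symm⟩⟩

end SimpleGraph

/-! ### Words of square arrays -/

/-- Division with remainder: the position `k = i * b + j` determines `i` and `j`. This matches
nested loops with the numbering of pairs by `finProdFinEquiv`. -/
theorem flatMap_range_flatMap {α : Type*} (a b : ℕ) (g : ℕ → ℕ → List α) :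
    (List.range a).flatMap (fun i => (List.range b).flatMap (g i)) =
      (List.range (a * b)).flatMap fun k => g (k / b) (k % b) := by
  induction a with
  | zero => simp
  | succ a ih =>
    rw [List.range_succ, List.flatMap_append, ih, Nat.succ_mul, List.range_add,
      List.flatMap_append]
    congr 1
    simp only [List.flatMap_cons, List.flatMap_nil, List.append_nil, List.flatMap_map]
    refine List.flatMap_congr fun j hj => ?_
    have hj := List.mem_range.1 hj
    rw [Nat.mul_comm, Nat.mul_add_div (by omega), Nat.mul_add_mod, Nat.div_eq_of_lt hj,
      Nat.mod_eq_of_lt hj, Nat.add_zero]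

theorem flatMap_range_map {α : Type*} (a b : ℕ) (g : ℕ → ℕ → α) :
    (List.range a).flatMap (fun i => (List.range b).map (g i)) =
      (List.range (a * b)).map fun k => g (k / b) (k % b) := by
  simpa [← List.map_eq_flatMap] using flatMap_range_flatMap a b fun i j => [g i j]

/-- The word of a square array, row by row. -/
def gridWord (n : ℕ) (f : ℕ → ℕ → ℕ) : Word :=
  (List.range n).flatMap fun i => (List.range n).map (f i)

theorem flatMap_finRange_eq_gridWord {n : ℕ} (g : Fin n → Fin n → ℕ) (f : ℕ → ℕ → ℕ)
    (h : ∀ i j : Fin n, f i j = g i j) :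
    ((List.finRange n).flatMap fun i => (List.finRange n).map (g i)) = gridWord n f := by
  simp only [gridWord, ← List.map_coe_finRange_eq_range, List.flatMap_map, List.map_map]
  refine List.flatMap_congr fun i _ => List.map_congr_left fun j _ => ?_
  simp [h]

theorem length_gridWord (n : ℕ) (f : ℕ → ℕ → ℕ) : (gridWord n f).length = n * n := by
  simp [gridWord, flatMap_range_map]

theorem getElem?_gridWord {n : ℕ} (f : ℕ → ℕ → ℕ) {i j : ℕ} (hi : i < n) (hj : j < n) :
    (gridWord n f)[i * n + j]? = some (f i j) := by
  have h : i * n + j < n * n := by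
    calc i * n + j < i * n + n := by omega
      _ = (i + 1) * n := by ring
      _ ≤ n * n := Nat.mul_le_mul_right _ hi
  rw [gridWord, flatMap_range_map, List.getElem?_map, List.getElem?_range h, Option.map_some,
    Nat.mul_comm, Nat.mul_add_div (by omega), Nat.mul_add_mod, Nat.div_eq_of_lt hj,
    Nat.mod_eq_of_lt hj, Nat.add_zero]

/-- Extension of a function on `Fin n` by zero. -/
def extendZero {n : ℕ} (g : Fin n → Fin n → ℕ) (i j : ℕ) : ℕ :=
  if h : i < n ∧ j < n then g ⟨i, h.1⟩ ⟨j, h.2⟩ else 0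

theorem extendZero_val {n : ℕ} (g : Fin n → Fin n → ℕ) (i j : Fin n) :
    extendZero g i j = g i j := by
  simp [extendZero]

theorem tableWord_eq_gridWord {G : Type} [Group G] {m : ℕ} (e : Fin m ≃ G) :
    tableWord e = gridWord m (extendZero fun i j => (e.symm (e i * e j) : ℕ)) :=
  flatMap_finRange_eq_gridWord _ _ (extendZero_val _)

open Classical in
theorem adjWord_eq_gridWord {n : ℕ} (X : SimpleGraph (Fin n)) :
    adjWord X = gridWord n (extendZero fun i j => if X.Adj i j then 1 else 0) :=
  flatMap_finRange_eq_gridWord _ _ (extendZero_val _)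

theorem length_tableWord {G : Type} [Group G] {m : ℕ} (e : Fin m ≃ G) :
    (tableWord e).length = m * m := by
  rw [tableWord_eq_gridWord, length_gridWord]

theorem length_adjWord {n : ℕ} (X : SimpleGraph (Fin n)) : (adjWord X).length = n * n := by
  rw [adjWord_eq_gridWord, length_gridWord]

theorem getElem?_tableWord {G : Type} [Group G] {m : ℕ} (e : Fin m ≃ G) (i j : Fin m) :
    (tableWord e)[(i * m + j : ℕ)]? = some ((e.symm (e i * e j) : Fin m) : ℕ) := by
  rw [tableWord_eq_gridWord, getElem?_gridWord _ i.2 j.2, extendZero_val]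

open Classical in
theorem getElem?_adjWord {n : ℕ} (X : SimpleGraph (Fin n)) (i j : Fin n) :
    (adjWord X)[(i * n + j : ℕ)]? = some (if X.Adj i j then 1 else 0) := by
  rw [adjWord_eq_gridWord, getElem?_gridWord _ i.2 j.2, extendZero_val]

theorem adjWord_injective {n : ℕ} : Function.Injective (adjWord (n := n)) := by
  classical
  intro X Y h
  ext i j
  have h₁ := getElem?_adjWord X i j
  rw [h, getElem?_adjWord Y i j, Option.some.injEq] at h₁
  split_ifs at h₁ with h₂ h₃ h₃ <;> simp_all

/-- The multiplication table determines the group. -/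
theorem nonempty_mulEquiv_of_tableWord_eq {G H : Type} [Group G] [Group H] {m : ℕ}
    {e : Fin m ≃ G} {f : Fin m ≃ H} (h : tableWord e = tableWord f) : Nonempty (G ≃* H) := by
  refine ⟨⟨e.symm.trans f, fun x y => ?_⟩⟩
  have h₁ := getElem?_tableWord e (e.symm x) (e.symm y)
  rw [h, getElem?_tableWord f, Option.some.injEq] at h₁
  have h₂ := congrArg f (Fin.ext h₁)
  simpa using h₂.symm

theorem Representable.of_mulEquiv {G H : Type*} [Group G] [Group H] {V : Type*}
    {X : SimpleGraph V} (f : G ≃* H) (h : Representable G X) : Representable H X := by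
  obtain ⟨ρ, g, hg⟩ := h
  exact ⟨ρ.comp f.symm.toMonoidHom, f g, by simpa using hg⟩

/-- The yes-instances quantify over all groups and graphs with the given encoding. The answer does
not depend on this choice, since the word determines the group up to isomorphism and the graph
exactly. -/
theorem groupGraphWord_mem_yes_iff {G : Type} [hG : Group G] [Group.IsSolvable G] {m n : ℕ}
    (e : Fin m ≃ G) (X : SimpleGraph (Fin n)) :
    groupGraphWord e X ∈ solvableRepresentability.yes ↔ Representable G X := by
  constructor
  · rintro ⟨H, _, m', n', f, Y, -, h, hH⟩
    simp only [groupGraphWord, List.cons.injEq] at h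
    obtain ⟨rfl, rfl, h⟩ := h
    obtain ⟨h₁, h₂⟩ := List.append_inj h (by rw [length_tableWord, length_tableWord])
    obtain ⟨φ⟩ := nonempty_mulEquiv_of_tableWord_eq h₁
    rw [adjWord_injective h₂]
    exact hH.of_mulEquiv φ.symm
  · exact fun h => ⟨G, hG, m, n, e, X, inferInstance, rfl, h⟩

theorem graphPairWord_mem_yes_iff {n k : ℕ} (X : SimpleGraph (Fin n)) (Y : SimpleGraph (Fin k)) :
    graphPairWord X Y ∈ graphIsomorphism.yes ↔ Nonempty (X ≃g Y) := by
  constructor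
  · rintro ⟨n', k', X', Y', h, hXY⟩
    simp only [graphPairWord, List.cons.injEq] at h
    obtain ⟨rfl, rfl, h⟩ := h
    obtain ⟨h₁, h₂⟩ := List.append_inj h (by rw [length_adjWord, length_adjWord])
    rwa [adjWord_injective h₁, adjWord_injective h₂]
  · exact fun h => ⟨n, k, X, Y, rfl, h⟩

/-! ### Bit lengths -/

theorem wordSize_cons (a : ℕ) (w : Word) : wordSize (a :: w) = Nat.size a + 1 + wordSize w := by
  simp [wordSize]

theorem wordSize_append (w w' : Word) : wordSize (w ++ w') = wordSize w + wordSize w' := by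
  simp [wordSize]

theorem length_le_wordSize (w : Word) : w.length ≤ wordSize w := by
  induction w with
  | nil => simp
  | cons a w ih => rw [wordSize_cons, List.length_cons]; omega

theorem wordSize_le_of_le_one {w : Word} (h : ∀ a ∈ w, a ≤ 1) : wordSize w ≤ 2 * w.length := by
  induction w with
  | nil => simp [wordSize]
  | cons a w ih =>
    have h₁ := ih fun b hb => h b (List.mem_cons_of_mem _ hb)
    have h₂ : Nat.size a ≤ 1 := by
      rw [Nat.size_le]
      have := h a List.mem_cons_self
      omega
    rw [wordSize_cons, List.length_cons]
    omega

theorem wordSize_adjWord_le {n : ℕ} (X : SimpleGraph (Fin n)) :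
    wordSize (adjWord X) ≤ 2 * (n * n) := by
  rw [← length_adjWord X]
  refine wordSize_le_of_le_one fun a ha => ?_
  simp only [adjWord, List.mem_flatMap, List.mem_map] at ha
  obtain ⟨i, -, j, -, rfl⟩ := ha
  split_ifs <;> simp

theorem wordSize_graphPairWord_le {n : ℕ} (X Y : SimpleGraph (Fin n)) :
    wordSize (graphPairWord X Y) ≤ 2 * (n + 1) + 4 * (n * n) := by
  have h : Nat.size n ≤ n := Nat.size_le.2 Nat.lt_two_pow_self
  rw [graphPairWord, wordSize_cons, wordSize_cons, wordSize_append]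
  have h₁ := wordSize_adjWord_le X
  have h₂ := wordSize_adjWord_le Y
  omega

/-- The tables have `m * m` and `n * n` letters, so loops of length `m` or `n` are polynomial in the
bit length although the numbers themselves are written in binary. -/
theorem le_wordSize_groupGraphWord {G : Type} [Group G] {m n : ℕ} (e : Fin m ≃ G)
    (X : SimpleGraph (Fin n)) :
    m ≤ wordSize (groupGraphWord e X) ∧ n ≤ wordSize (groupGraphWord e X) := by
  have h := length_le_wordSize (groupGraphWord e X)
  simp only [groupGraphWord, List.length_cons, List.length_append, length_tableWord,
    length_adjWord] at h ⊢
  constructor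
  · exact (Nat.le_mul_self m).trans (by omega)
  · exact (Nat.le_mul_self n).trans (by omega)

open Classical in
/-- The adjacency matrix of a graph with marked vertices, enumerated by four nested loops. -/
theorem adjWord_markedGraph {n : ℕ} (X : SimpleGraph (Fin n)) (i j : ℕ) (F : ℕ → ℕ → ℕ → ℕ → ℕ)
    (hF : ∀ (u v : Fin n) (a b : ℕ), F u a v b = if ((a = 0 ∧ b = 0 ∧ X.Adj u v) ∨
      (u = v ∧ (a = 0 ∨ b = 0) ∧ 0 < a + b ∧ a + b ≤ SimpleGraph.mark i j u)) then 1 else 0) :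
    ((List.range n).flatMap fun u => (List.range (n + 3)).flatMap fun a =>
      (List.range n).flatMap fun v => (List.range (n + 3)).map fun b => F u a v b) =
      adjWord (X.markedGraph i j) := by
  rw [adjWord, flatMap_finRange_eq_gridWord _ fun p q =>
    F (p / (n + 3)) (p % (n + 3)) (q / (n + 3)) (q % (n + 3))]
  · have h (u a : ℕ) := flatMap_range_map n (n + 3) (F u a)
    simp only [h, gridWord]
    exact flatMap_range_flatMap n (n + 3) _
  · exact fun p q => (hF (finProdFinEquiv.symm p).1 (finProdFinEquiv.symm q).1
      (finProdFinEquiv.symm p).2 (finProdFinEquiv.symm q).2).trans (if_congr Iff.rfl rfl rfl)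

/-! ### The algorithm -/

namespace OracleRAM

namespace Cmd

/-- A loop in which every round adds a number to the variable `r`. -/
theorem eval_loop_sum {O : Set Word} {x y : ℕ} {P : Cmd} {s : State} (r : ℕ) (f : ℕ → ℕ)
    (h : ∀ k < s.reg y, ∀ s', Frame (loop x y P) s s' →
      (P.eval O (s'.setReg x k)).reg r = s'.reg r + f k) :
    ((loop x y P).eval O s).reg r = s.reg r + ∑ k ∈ Finset.range (s.reg y), f k := by
  refine eval_loop_induction (x := x) (y := y) (P := P)
    (I := fun k s' => s'.reg r = s.reg r + ∑ l ∈ Finset.range k, f l) (by simp)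
    fun k hk s' hf ih => ?_
  rw [h k hk s' hf, ih, Finset.sum_range_succ, add_assoc]

/-- A loop in which every round adds elements to a set that is represented in the state. -/
theorem eval_loop_union {O : Set Word} {x y : ℕ} {P : Cmd} {s : State} {α : Type*}
    (S : State → Set α) (T : ℕ → Set α)
    (h : ∀ k < s.reg y, ∀ s', Frame (loop x y P) s s' →
      S (P.eval O (s'.setReg x k)) = S s' ∪ T k) :
    S ((loop x y P).eval O s) = S s ∪ {a | ∃ k < s.reg y, a ∈ T k} := by
  refine eval_loop_induction (x := x) (y := y) (P := P)
    (I := fun k s' => S s' = S s ∪ {a | ∃ l < k, a ∈ T l}) (by simp) fun k hk s' hf ih => ?_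
  rw [h k hk s' hf, ih]
  ext a
  simp only [Set.mem_union, Set.mem_ofPred_eq, Nat.lt_succ_iff_lt_or_eq]
  constructor
  · rintro ((ha | ⟨l, hl, ha⟩) | ha)
    · exact Or.inl ha
    · exact Or.inr ⟨l, Or.inl hl, ha⟩
    · exact Or.inr ⟨k, Or.inr rfl, ha⟩
  · rintro (ha | ⟨l, hl | rfl, ha⟩)
    · exact Or.inl (Or.inl ha)
    · exact Or.inl (Or.inr ⟨l, hl, ha⟩)
    · exact Or.inr ha

end Cmd

open Cmd

/-- The product of two group elements, looked up in the multiplication table. -/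
def mulExpr (e f : Expr) : Expr := .load 0 (.add (.load 1 e) f)

/-- An entry of the adjacency matrix. -/
def adjExpr (e f : Expr) : Expr := .load 0 (.add (.load 2 e) f)

/-- Read the order `m` of the group and the number `n` of vertices into the variables `1` and `2`,
and the loop bounds `n + 3`, `m + 1`, `n + 1` into the variables `3`, `4`, `5`. -/
def readSizes : Cmd :=
  seq (set 1 (.load 0 (.lit 0))) (seq (set 2 (.load 0 (.lit 1)))
    (seq (set 3 (.add (.var 2) (.lit 3))) (seq (set 4 (.add (.var 1) (.lit 1)))
      (set 5 (.add (.var 2) (.lit 1))))))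

/-- Write the addresses of the rows of the multiplication table into the memory bank `1`, and
those of the rows of the adjacency matrix into the memory bank `2`. -/
def computeRows : Cmd :=
  seq (set 10 (.lit 2)) (seq
    (loop 11 1 (seq (store 1 (.var 11) (.var 10)) (set 10 (.add (.var 10) (.var 1)))))
    (loop 11 2 (seq (store 2 (.var 11) (.var 10)) (set 10 (.add (.var 10) (.var 2))))))

/-- Mark the commutators in the memory bank `3`. -/
def markCommutators : Cmd :=
  loop 11 1 (loop 12 1 (loop 13 1 (store 3 (.var 13) (.add (.load 3 (.var 13))
    (.eq (mulExpr (.var 13) (mulExpr (.var 12) (.var 11))) (mulExpr (.var 11) (.var 12)))))))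

/-- Mark the products of marked elements. -/
def markProducts : Cmd :=
  loop 11 1 (loop 12 1 (store 3 (mulExpr (.var 11) (.var 12))
    (.add (.load 3 (mulExpr (.var 11) (.var 12)))
      (.and (.load 3 (.var 11)) (.load 3 (.var 12))))))

/-- Put the number of marked elements into the variable `15`. -/
def countMarked : Cmd :=
  seq (set 15 (.lit 0)) (loop 11 1 (set 15 (.add (.var 15) (.not (.not (.load 3 (.var 11)))))))

/-- Put the order of the commutator subgroup into the variable `15`. -/
def commutatorOrder : Cmd :=
  seq markCommutators (seq (loop 14 1 markProducts) countMarked)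

/-- The comparison of a number with a weight: the variable `17` is the number of marked vertices
before the vertex in the variable `j`. -/
def leMarkExpr (j : ℕ) (c u : Expr) : Expr :=
  .or (.le c (.lit 2)) (.or (.and (.eq u (.var j)) (.le c (.add (.var 17) (.lit 3))))
    (.and (.and (.not (.eq u (.var j))) (.not (.le (.var 17) u))) (.le c (.add u (.lit 3)))))

/-- An entry of the adjacency matrix of a graph with marked vertices. -/
def entryExpr (j : ℕ) : Expr :=
  .or (.and (.and (.not (.var 21)) (.not (.var 23))) (adjExpr (.var 20) (.var 22)))
    (.and (.and (.eq (.var 20) (.var 22)) (.or (.not (.var 21)) (.not (.var 23))))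
      (.and (.add (.var 21) (.var 23)) (leMarkExpr j (.add (.var 21) (.var 23)) (.var 20))))

/-- Append the adjacency matrix of a graph with marked vertices to the memory bank `4`. -/
def emitMarkedGraph (j : ℕ) : Cmd :=
  loop 20 2 (loop 21 3 (loop 22 2 (loop 23 3 (emit 4 10 (entryExpr j)))))

/-- Write the query whether an automorphism fixes the vertices before `i` and maps `i` to `j`,
where `i` and `j` are the variables `17` and `18`. -/
def writeQuery : Cmd :=
  seq (set 10 (.lit 0)) (seq (emit 4 10 (.var 31)) (seq (emit 4 10 (.var 31))
    (seq (emitMarkedGraph 17) (emitMarkedGraph 18))))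

/-- Put the length of the orbit of `i` into the variable `19`. -/
def orbitLength : Cmd :=
  seq (set 19 (.lit 0)) (loop 18 2 (seq writeQuery (seq (query 24 4 (.var 10))
    (set 19 (.add (.var 19) (.var 24))))))

/-- Put into the variable `f` whether `t` is a multiple `q * e` with `q` less than `y`. -/
def isMultiple (f y e t : ℕ) : Cmd :=
  seq (set f (.lit 0)) (seq (set 27 (.lit 0)) (loop 30 y
    (seq (set f (.add (.var f) (.eq (.var 27) (.var t)))) (set 27 (.add (.var 27) (.var e))))))

/-- Make the variable `16` nonzero if some `k` greater than `1` divides the orbit length and the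
index of the commutator subgroup. -/
def searchDivisor : Cmd :=
  seq (set 26 (.lit 0)) (loop 25 5 (seq (isMultiple 28 4 26 1) (seq (isMultiple 29 5 25 19)
    (seq (set 16 (.add (.var 16) (.and (.sub (.var 25) (.lit 1)) (.and (.var 28) (.var 29)))))
      (set 26 (.add (.var 26) (.var 15)))))))

/-- The search for a common divisor, over all vertices `i`. -/
def searchVertices : Cmd := loop 17 2 (seq orbitLength searchDivisor)

/-- The algorithm after the sizes have been read. -/
def decideSized : Cmd :=
  seq computeRows (seq commutatorOrder (seq (set 31 (.lit 0)) (seq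
    (loop 11 2 (set 31 (.add (.var 31) (.var 3)))) (seq (set 16 (.lit 0)) (seq searchVertices
      (set 0 (.var 16)))))))

/-! ### Correctness of the computation of the order of the commutator subgroup -/

variable {G : Type} [Group G] {m n : ℕ}

open Classical in
/-- The sizes and the addresses of rows have been computed. -/
structure Ready (e : Fin m ≃ G) (X : SimpleGraph (Fin n)) (s : State) : Prop where
  reg_one : s.reg 1 = m
  reg_two : s.reg 2 = n
  reg_three : s.reg 3 = n + 3
  reg_four : s.reg 4 = m + 1
  reg_five : s.reg 5 = n + 1
  mul : ∀ i j : Fin m, s.mem 0 (s.mem 1 i + j) = (e.symm (e i * e j) : Fin m)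
  adj : ∀ i j : Fin n, s.mem 0 (s.mem 2 i + j) = if X.Adj i j then 1 else 0

theorem Ready.of_frame {e : Fin m ≃ G} {X : SimpleGraph (Fin n)} {c : Cmd} {s s' : State}
    (h : Ready e X s) (hf : Frame c s s') (hc : c.tame = true)
    (hm : (c.writesMem 0 || c.writesMem 1 || c.writesMem 2) = false) : Ready e X s' := by
  simp only [Bool.or_eq_false_iff] at hm
  have hr (r : ℕ) (h : isSize r = true) := hf.reg r (tame.writesReg_eq_false hc h)
  refine ⟨?_, ?_, ?_, ?_, ?_, ?_, ?_⟩
  · rw [hr 1 rfl, h.reg_one]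
  · rw [hr 2 rfl, h.reg_two]
  · rw [hr 3 rfl, h.reg_three]
  · rw [hr 4 rfl, h.reg_four]
  · rw [hr 5 rfl, h.reg_five]
  · intro i j
    rw [hf.mem 0 hm.1.1, hf.mem 1 hm.1.2, h.mul]
  · intro i j
    rw [hf.mem 0 hm.1.1, hf.mem 2 hm.2, h.adj]

theorem Ready.setReg {e : Fin m ≃ G} {X : SimpleGraph (Fin n)} {s : State} (h : Ready e X s)
    {x : ℕ} (hx : isSize x = false) (v : ℕ) : Ready e X (s.setReg x v) :=
  h.of_frame (frame_eval ∅ (set x (.lit v)) s) (by simp [tame, hx]) rfl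

/-- The group elements that are marked in the memory bank `3`. -/
def marked (e : Fin m ≃ G) (s : State) : Set G := {g | s.mem 3 (e.symm g) ≠ 0}

section

variable {O : Set Word} {e : Fin m ≃ G} {X : SimpleGraph (Fin n)} {s : State}

theorem Ready.eval_mulExpr (h : Ready e X s) {f f' : Expr} {i j : Fin m} (hi : f.eval s = i)
    (hj : f'.eval s = j) : (mulExpr f f').eval s = (e.symm (e i * e j) : Fin m) := by
  simp only [mulExpr, Expr.eval, hi, hj, h.mul]

open scoped commutatorElement in
-- The element `z` is the commutator of `x` and `y` if and only if `z * (y * x) = x * y`. This test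
-- needs no inverses, only the table.
theorem eval_markCommutators (h : Ready e X s) :
    marked e (markCommutators.eval O s) = marked e s ∪ commutatorSet G := by
  have h₁ := eval_loop_union (O := O) (x := 11) (y := 1) (s := s) (marked e)
    (P := loop 12 1 (loop 13 1 (store 3 (.var 13) (.add (.load 3 (.var 13))
    (.eq (mulExpr (.var 13) (mulExpr (.var 12) (.var 11))) (mulExpr (.var 11) (.var 12)))))))
    (fun x => {a | ∃ y < m, a ∈ {b : G | ∃ z < m, b ∈
      {g : G | (e.symm g : ℕ) = z ∧ ∃ i j : Fin m, (i : ℕ) = x ∧ (j : ℕ) = y ∧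
        g * (e j * e i) = e i * e j}}}) ?_
  · rw [markCommutators, h₁, h.reg_one]
    congr 1
    ext g
    simp only [Set.mem_ofPred_eq, mem_commutatorSet_iff]
    constructor
    · rintro ⟨x, -, y, -, z, -, -, i, j, -, -, hg⟩
      refine ⟨e i, e j, ?_⟩
      rw [commutatorElement_def, ← hg]
      group
    · rintro ⟨x, y, rfl⟩
      refine ⟨_, (e.symm x).2, _, (e.symm y).2, _, (e.symm ⁅x, y⁆).2, rfl, _, _, rfl, rfl, ?_⟩
      simp [commutatorElement_def, mul_assoc]
  intro x hx s₁ hf₁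
  rw [h.reg_one] at hx
  have r₁ := (h.of_frame hf₁ rfl rfl).setReg (x := 11) rfl x
  rw [eval_loop_union (marked e) (fun y => {b : G | ∃ z < m, b ∈
      {g : G | (e.symm g : ℕ) = z ∧ ∃ i j : Fin m, (i : ℕ) = x ∧ (j : ℕ) = y ∧
        g * (e j * e i) = e i * e j}}), r₁.reg_one]
  · rfl
  intro y hy s₂ hf₂
  rw [r₁.reg_one] at hy
  have r₂ := (r₁.of_frame hf₂ rfl rfl).setReg (x := 12) rfl y
  have x₂ := hf₂.reg 11 rfl
  rw [eval_loop_union (marked e) (fun z => {g : G | (e.symm g : ℕ) = z ∧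
    ∃ i j : Fin m, (i : ℕ) = x ∧ (j : ℕ) = y ∧ g * (e j * e i) = e i * e j}), r₂.reg_one]
  · rfl
  intro z hz s₃ hf₃
  rw [r₂.reg_one] at hz
  have r₃ := (r₂.of_frame hf₃ rfl rfl).setReg (x := 13) rfl z
  have x₃ : (Expr.var 11).eval (s₃.setReg 13 z) = x := by
    simpa [Expr.eval, x₂] using hf₃.reg 11 rfl
  have y₃ : (Expr.var 12).eval (s₃.setReg 13 z) = y := by
    simpa [Expr.eval] using hf₃.reg 12 rfl
  have z₃ : (Expr.var 13).eval (s₃.setReg 13 z) = z := by simp [Expr.eval]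
  have e₁ := r₃.eval_mulExpr (i := ⟨y, hy⟩) (j := ⟨x, hx⟩) y₃ x₃
  have e₂ := r₃.eval_mulExpr (i := ⟨z, hz⟩) z₃ e₁
  have e₃ := r₃.eval_mulExpr (i := ⟨x, hx⟩) (j := ⟨y, hy⟩) x₃ y₃
  ext g
  simp only [marked, eval, Expr.eval_eq, e₂, e₃, Expr.eval, Set.mem_ofPred_eq, Set.mem_union,
    State.setMem_mem, State.setReg_reg, State.setReg_mem, if_true, true_and]
  by_cases hg : (e.symm g : ℕ) = z
  · have hg' : g = e ⟨z, hz⟩ := by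
      rw [← e.symm_apply_eq]; exact Fin.ext hg
    subst hg'
    simp only [Equiv.symm_apply_apply, if_true, true_and, Equiv.apply_symm_apply]
    have : (∃ i j : Fin m, (i : ℕ) = x ∧ (j : ℕ) = y ∧
        e ⟨z, hz⟩ * (e j * e i) = e i * e j) ↔
        e ⟨z, hz⟩ * (e ⟨y, hy⟩ * e ⟨x, hx⟩) = e ⟨x, hx⟩ * e ⟨y, hy⟩ := by
      constructor
      · rintro ⟨i, j, rfl, rfl, h⟩
        exact h
      · exact fun h => ⟨⟨x, hx⟩, ⟨y, hy⟩, rfl, rfl, h⟩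
    rw [this, ← e.symm.injective.eq_iff, Fin.ext_iff]
    split_ifs with h₂ <;> simp [h₂]
  · simp [hg]

/-- Marks are set in place, so a pass may also multiply elements marked during the same pass. Hence
the result is only bounded: from below by the products of the elements marked at the start, and from
above by every subgroup that contains these. -/
theorem eval_markProducts (h : Ready e X s) (H : Subgroup G) :
    marked e s ⊆ marked e (markProducts.eval O s) ∧
    (∀ x ∈ marked e s, ∀ y ∈ marked e s, x * y ∈ marked e (markProducts.eval O s)) ∧
    (marked e s ⊆ H → marked e (markProducts.eval O s) ⊆ H) := by
  have h₁ := eval_loop_induction (O := O) (x := 11) (y := 1) (s := s)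
    (P := loop 12 1 (store 3 (mulExpr (.var 11) (.var 12))
      (.add (.load 3 (mulExpr (.var 11) (.var 12)))
      (.and (.load 3 (.var 11)) (.load 3 (.var 12))))))
    (fun k s' => marked e s ⊆ marked e s' ∧
      (∀ i : Fin m, (i : ℕ) < k → ∀ j : Fin m, e i ∈ marked e s → e j ∈ marked e s →
        e i * e j ∈ marked e s') ∧
      (marked e s ⊆ H → marked e s' ⊆ H)) ⟨fun _ h => h, fun i hi => by omega, fun h => h⟩ ?_
  · refine ⟨h₁.1, fun x hx y hy => ?_, h₁.2.2⟩
    have := h₁.2.1 (e.symm x) (by rw [h.reg_one]; exact (e.symm x).2) (e.symm y)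
    simp only [Equiv.apply_symm_apply] at this
    exact this hx hy
  intro x hx s₁ hf₁ I₁
  rw [h.reg_one] at hx
  have r₁ := (h.of_frame hf₁ rfl rfl).setReg (x := 11) rfl x
  have h₂ := eval_loop_induction (O := O) (x := 12) (y := 1) (s := s₁.setReg 11 x)
    (P := store 3 (mulExpr (.var 11) (.var 12))
      (.add (.load 3 (mulExpr (.var 11) (.var 12)))
      (.and (.load 3 (.var 11)) (.load 3 (.var 12)))))
    (fun k s' => marked e s₁ ⊆ marked e s' ∧
      (∀ j : Fin m, (j : ℕ) < k → e ⟨x, hx⟩ ∈ marked e s₁ → e j ∈ marked e s₁ →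
        e ⟨x, hx⟩ * e j ∈ marked e s') ∧
      (marked e s₁ ⊆ H → marked e s' ⊆ H)) ⟨fun _ h => h, fun i hi => by omega, fun h => h⟩ ?_
  · refine ⟨I₁.1.trans h₂.1, fun i hi j hi' hj => ?_, fun hH => h₂.2.2 (I₁.2.2 hH)⟩
    rcases Nat.lt_succ_iff_lt_or_eq.1 hi with hlt | rfl
    · exact h₂.1 (I₁.2.1 i hlt j hi' hj)
    · exact h₂.2.1 j (by rw [r₁.reg_one]; exact j.2) (I₁.1 hi') (I₁.1 hj)
  intro y hy s₂ hf₂ I₂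
  rw [r₁.reg_one] at hy
  have r₂ := (r₁.of_frame hf₂ rfl rfl).setReg (x := 12) rfl y
  have x₂ : (Expr.var 11).eval (s₂.setReg 12 y) = x := by
    simpa [Expr.eval] using hf₂.reg 11 rfl
  have y₂ : (Expr.var 12).eval (s₂.setReg 12 y) = y := by simp [Expr.eval]
  have e₂ := r₂.eval_mulExpr (i := ⟨x, hx⟩) (j := ⟨y, hy⟩) x₂ y₂
  have key : ∀ g, g ∈ marked e ((store 3 (mulExpr (.var 11) (.var 12))
      (.add (.load 3 (mulExpr (.var 11) (.var 12)))
      (.and (.load 3 (.var 11)) (.load 3 (.var 12))))).eval O (s₂.setReg 12 y)) ↔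
      g ∈ marked e s₂ ∨ (g = e ⟨x, hx⟩ * e ⟨y, hy⟩ ∧ e ⟨x, hx⟩ ∈ marked e s₂ ∧
        e ⟨y, hy⟩ ∈ marked e s₂) := by
    intro g
    have x₂' : s₂.reg 11 = x := by simpa [Expr.eval] using x₂
    simp only [marked, eval, Expr.eval_and, e₂, Expr.eval, Set.mem_ofPred_eq, State.setMem_mem,
      State.setReg_reg, State.setReg_mem, if_true, true_and, Equiv.symm_apply_apply]
    by_cases hg : g = e ⟨x, hx⟩ * e ⟨y, hy⟩
    · subst hg
      simp only [if_true, true_and]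
      split_ifs with h₃ <;> simp_all
    · have hg' : (e.symm g : ℕ) ≠ (e.symm (e ⟨x, hx⟩ * e ⟨y, hy⟩) : Fin m) := fun h =>
        hg (e.symm.injective (Fin.ext h))
      simp [hg, hg']
  refine ⟨fun g hg => (key g).2 (Or.inl (I₂.1 hg)), fun j hj hx' hj' => ?_, fun hH g hg => ?_⟩
  · rcases Nat.lt_succ_iff_lt_or_eq.1 hj with hlt | rfl
    · exact (key _).2 (Or.inl (I₂.2.1 j hlt hx' hj'))
    · exact (key _).2 (Or.inr ⟨rfl, I₂.1 hx', I₂.1 hj'⟩)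
  · rcases (key g).1 hg with h₃ | ⟨rfl, h₃, h₄⟩
    · exact I₂.2.2 hH h₃
    · exact H.mul_mem (I₂.2.2 hH h₃) (I₂.2.2 hH h₄)

/-- A finite set that contains the commutators and is closed under products contains the
commutator subgroup. -/
theorem commutator_subset_of_mul_mem [Finite G] {S : Set G} (h₁ : commutatorSet G ⊆ S)
    (h₂ : ∀ x ∈ S, ∀ y ∈ S, x * y ∈ S) : (commutator G : Set G) ⊆ S := by
  let M : Submonoid G :=
    { carrier := S
      mul_mem' := fun hx hy => h₂ _ hx _ hy
      one_mem' := h₁ (one_mem_commutatorSet G) }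
  let K : Subgroup G :=
    { M with
      inv_mem' := fun {x} hx => by
        -- In a finite group inverses are powers, so closure under products suffices.
        have h : x⁻¹ = x ^ (Nat.card G - 1) := by
          refine inv_eq_of_mul_eq_one_right ?_
          rw [← pow_succ', Nat.sub_add_cancel Nat.card_pos, pow_card_eq_one']
        rw [h]
        exact M.pow_mem hx _ }
  have : commutator G ≤ K := by
    rw [commutator_eq_closure, Subgroup.closure_le]
    exact h₁
  exact this

theorem ncard_eq_card_filter {N : ℕ} (T : Set (Fin N)) (p : ℕ → Prop) [DecidablePred p]
    (h : ∀ i : Fin N, p i ↔ i ∈ T) : T.ncard = ∑ i ∈ Finset.range N, if p i then 1 else 0 := by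
  classical
  rw [← Fin.sum_univ_eq_sum_range (fun i => if p i then 1 else 0)]
  simp only [h]
  rw [Finset.sum_boole, ← Set.ncard_coe_finset]
  simp

theorem eval_countMarked (h : Ready e X s) :
    (countMarked.eval O s).reg 15 = (marked e s).ncard := by
  have r := h.setReg (x := 15) rfl 0
  -- The cells of bank `3` accumulate and may exceed 1; the double negation in `countMarked` makes
  -- every mark count once.
  rw [countMarked, eval, eval_loop_sum 15 fun k => if s.mem 3 k ≠ 0 then 1 else 0]
  · simp only [eval, Expr.eval]
    rw [r.reg_one, ← ncard_eq_card_filter (e ⁻¹' marked e s)]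
    · rw [State.setReg_reg, if_pos rfl, zero_add, Set.ncard_preimage_of_injective_subset_range
        e.injective (by simp)]
    · simp [marked]
  · intro k hk s' hf
    have h₄ := hf.mem 3 rfl
    simp only [eval, Expr.eval, Expr.eval_not, State.setReg_reg, State.setReg_mem] at h₄ ⊢
    rw [h₄]
    simp

/-- A pass that marks nothing new shows that the marked set is closed under products, hence is the
whole commutator subgroup. Every other pass marks at least one new element, so `m` passes are
enough. -/
theorem eval_commutatorOrder [Finite G] (h : Ready e X s) (h₀ : s.mem 3 = 0) :
    (commutatorOrder.eval O s).reg 15 = Nat.card (commutator G) := by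
  have hm : Nat.card G = m := by rw [← Nat.card_congr e, Nat.card_fin]
  have hs : marked e s = ∅ := by ext; simp [marked, h₀]
  have h₁ := eval_markCommutators (O := O) h
  rw [hs, Set.empty_union] at h₁
  have r₁ := h.of_frame (frame_eval O markCommutators s) rfl rfl
  have h₂ := eval_loop_induction (O := O) (x := 14) (y := 1) (P := markProducts)
    (s := markCommutators.eval O s)
    (fun k s' => commutatorSet G ⊆ marked e s' ∧ marked e s' ⊆ commutator G ∧
      ((commutator G : Set G) ⊆ marked e s' ∨ k + 1 ≤ (marked e s').ncard)) ?_ ?_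
  · rw [r₁.reg_one] at h₂
    have h₃ : marked e ((loop 14 1 markProducts).eval O (markCommutators.eval O s)) =
        commutator G := by
      refine Set.Subset.antisymm h₂.2.1 ?_
      rcases h₂.2.2 with h₃ | h₃
      · exact h₃
      -- After `m` passes the other alternative would give `m + 1` marked elements in a group of
      -- order `m`.
      · have := Set.ncard_le_card (marked e ((loop 14 1 markProducts).eval O
          (markCommutators.eval O s)))
        omega
    have r₂ := r₁.of_frame (frame_eval O (loop 14 1 markProducts) _) rfl rfl
    rw [commutatorOrder, eval, eval, eval_countMarked r₂, h₃]
    rfl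
  · rw [h₁]
    refine ⟨le_rfl, ?_, Or.inr ?_⟩
    · rw [commutator_eq_closure]
      exact Subgroup.subset_closure
    -- The count starts at 1 because the identity is a commutator.
    · rw [zero_add, Nat.one_le_iff_ne_zero, ← Nat.pos_iff_ne_zero, Set.ncard_pos]
      exact ⟨1, one_mem_commutatorSet G⟩
  · intro k hk s' hf ⟨i₁, i₂, i₃⟩
    have r' := (r₁.of_frame hf rfl rfl).setReg (x := 14) rfl k
    obtain ⟨p₁, p₂, p₃⟩ := eval_markProducts (O := O) r' (commutator G)
    change marked e s' ⊆ _ at p₁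
    change ∀ x ∈ marked e s', ∀ y ∈ marked e s', _ at p₂
    refine ⟨i₁.trans p₁, p₃ i₂, ?_⟩
    rcases i₃ with i₃ | i₃
    · exact Or.inl (i₃.trans p₁)
    by_cases heq : marked e s' = marked e (markProducts.eval O (s'.setReg 14 k))
    · rw [← heq] at p₂ ⊢
      exact Or.inl (commutator_subset_of_mul_mem i₁ p₂)
    · right
      have := Set.ncard_lt_ncard (p₁.ssubset_of_ne heq)
      omega

end

end OracleRAM

/-! ### Correctness of the queries and of the divisibility test -/

namespace OracleRAM

open Cmd

variable {G : Type} [Group G] {m n : ℕ} {O : Set Word} {e : Fin m ≃ G} {X : SimpleGraph (Fin n)}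
  {s : State}

theorem eval_entryExpr {u v : Fin n} {a b i j x : ℕ} (h : Ready e X s) (hi : s.reg 17 = i)
    (hj : s.reg x = j) (hu : s.reg 20 = u) (ha : s.reg 21 = a) (hv : s.reg 22 = v)
    (hb : s.reg 23 = b) [Decidable ((a = 0 ∧ b = 0 ∧ X.Adj u v) ∨
      (u = v ∧ (a = 0 ∨ b = 0) ∧ 0 < a + b ∧ a + b ≤ SimpleGraph.mark i j u))] :
    (entryExpr x).eval s = if ((a = 0 ∧ b = 0 ∧ X.Adj u v) ∨
      (u = v ∧ (a = 0 ∨ b = 0) ∧ 0 < a + b ∧ a + b ≤ SimpleGraph.mark i j u)) then 1 else 0 := by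
  classical
  have hm : (leMarkExpr x (.add (.var 21) (.var 23)) (.var 20)).eval s ≠ 0 ↔
      a + b ≤ SimpleGraph.mark i j u := by
    simp only [leMarkExpr, Expr.eval_or, Expr.eval_and, Expr.eval_not, Expr.eval_le, Expr.eval_eq,
      Expr.eval, hi, hj, hu, ha, hb, SimpleGraph.mark]
    by_cases h₁ : (u : ℕ) = j
    · simp [h₁]; omega
    · by_cases h₂ : (u : ℕ) < i
      · simp [h₁, h₂]; omega
      · simp [h₁, h₂]
  have hadj : (adjExpr (.var 20) (.var 22)).eval s ≠ 0 ↔ X.Adj u v := by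
    simp only [adjExpr, Expr.eval, hu, hv, h.adj]
    split_ifs with h₁ <;> simp [h₁]
  rw [entryExpr, Expr.eval_or, Expr.eval_and, Expr.eval_and, Expr.eval_and, Expr.eval_and,
    Expr.eval_and]
  refine if_congr (or_congr ?_ ?_) rfl rfl
  · simp only [ite_ne_right_iff, hadj]
    simp [Expr.eval_not, Expr.eval, ha, hb, and_assoc]
  · simp only [ite_ne_right_iff, hm]
    simp [Expr.eval_not, Expr.eval_or, Expr.eval_eq, Expr.eval, ha, hb, hu, hv, and_assoc,
      Fin.ext_iff]
    omega

/-- The entry of the adjacency matrix of a marked graph at the positions `(u, a)` and `(v, b)`. -/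
noncomputable def markedEntry (X : SimpleGraph (Fin n)) (i j u a v b : ℕ) : ℕ :=
  open Classical in
  if h : u < n ∧ v < n then
    if ((a = 0 ∧ b = 0 ∧ X.Adj ⟨u, h.1⟩ ⟨v, h.2⟩) ∨
      ((⟨u, h.1⟩ : Fin n) = ⟨v, h.2⟩ ∧ (a = 0 ∨ b = 0) ∧ 0 < a + b ∧
        a + b ≤ SimpleGraph.mark i j u)) then 1 else 0
  else 0

/-- The two outer loops run through the row index `(u, a)` and the two inner ones through the column
index `(v, b)`. At each level the frame carries along the registers that the entry depends on. -/
theorem emits_emitMarkedGraph (h : Ready e X s) {x i j : ℕ} (hx : x = 17 ∨ x = 18)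
    (hi : s.reg 17 = i) (hj : s.reg x = j) :
    Emits O (emitMarkedGraph x) 4 10 s (adjWord (X.markedGraph i j)) := by
  have hw : (emitMarkedGraph x).writesReg x = false := by rcases hx with rfl | rfl <;> rfl
  have hx' : x ≠ 20 ∧ x ≠ 21 ∧ x ≠ 22 ∧ x ≠ 23 := by omega
  rw [← adjWord_markedGraph X i j (markedEntry X i j) (by
    intro u v a b
    rw [markedEntry, dif_pos ⟨u.2, v.2⟩])]
  have h₁ := Emits.loop (O := O) (x := 20) (y := 2) (a := 4) (p := 10) (s := s)
    (P := loop 21 3 (loop 22 2 (loop 23 3 (emit 4 10 (entryExpr x)))))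
    (L := fun u => (List.range (n + 3)).flatMap fun a =>
      (List.range n).flatMap fun v => (List.range (n + 3)).map fun b => markedEntry X i j u a v b)
    (by simp) ?_
  · rwa [h.reg_two] at h₁
  intro u hu s₁ f₁
  rw [h.reg_two] at hu
  have r₁ := (h.of_frame f₁ rfl rfl).setReg (x := 20) rfl u
  have i₁ := (f₁.reg 17 rfl).trans hi
  have j₁ := (f₁.reg x hw).trans hj
  have h₂ := Emits.loop (O := O) (x := 21) (y := 3) (a := 4) (p := 10) (s := s₁.setReg 20 u)
    (P := loop 22 2 (loop 23 3 (emit 4 10 (entryExpr x))))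
    (L := fun a =>
      (List.range n).flatMap fun v => (List.range (n + 3)).map fun b => markedEntry X i j u a v b)
    (by simp) ?_
  · rwa [r₁.reg_three] at h₂
  intro a ha s₂ f₂
  rw [r₁.reg_three] at ha
  have r₂ := (r₁.of_frame f₂ rfl rfl).setReg (x := 21) rfl a
  have u₂ := f₂.reg 20 rfl
  have i₂ := f₂.reg 17 rfl
  have hw₂ : (loop 21 3 (loop 22 2 (loop 23 3 (emit 4 10 (entryExpr x))))).writesReg x = false := by
    rcases hx with rfl | rfl <;> rfl
  have j₂ := f₂.reg x hw₂
  simp only [State.setReg_reg, hx'.1, if_false, if_true, i₁, j₁, Nat.reduceEqDiff] at u₂ i₂ j₂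
  have h₃ := Emits.loop (O := O) (x := 22) (y := 2) (a := 4) (p := 10) (s := s₂.setReg 21 a)
    (P := loop 23 3 (emit 4 10 (entryExpr x)))
    (L := fun v => (List.range (n + 3)).map fun b => markedEntry X i j u a v b)
    (by simp) ?_
  · rwa [r₂.reg_two] at h₃
  intro v hv s₃ f₃
  rw [r₂.reg_two] at hv
  have r₃ := (r₂.of_frame f₃ rfl rfl).setReg (x := 22) rfl v
  have u₃ := f₃.reg 20 rfl
  have a₃ := f₃.reg 21 rfl
  have i₃ := f₃.reg 17 rfl
  have hw₃ : (loop 22 2 (loop 23 3 (emit 4 10 (entryExpr x)))).writesReg x = false := by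
    rcases hx with rfl | rfl <;> rfl
  have j₃ := f₃.reg x hw₃
  simp only [State.setReg_reg, hx'.2.1, if_false, if_true, i₂, j₂, u₂, Nat.reduceEqDiff]
    at u₃ i₃ j₃ a₃
  have h₄ := Emits.loop (O := O) (x := 23) (y := 3) (a := 4) (p := 10) (s := s₃.setReg 22 v)
    (P := emit 4 10 (entryExpr x))
    (L := fun b => [markedEntry X i j u a v b])
    (by simp) ?_
  · rw [r₃.reg_three] at h₄
    rwa [List.map_eq_flatMap]
  intro b hb s₄ f₄
  have r₄ := (r₃.of_frame f₄ rfl rfl).setReg (x := 23) rfl b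
  have u₄ := f₄.reg 20 rfl
  have a₄ := f₄.reg 21 rfl
  have v₄ := f₄.reg 22 rfl
  have i₄ := f₄.reg 17 rfl
  have hw₄ : (loop 23 3 (emit 4 10 (entryExpr x))).writesReg x = false := by
    rcases hx with rfl | rfl <;> rfl
  have j₄ := f₄.reg x hw₄
  simp only [State.setReg_reg, hx'.2.2.1, if_false, if_true, i₃, j₃, u₃, a₃, Nat.reduceEqDiff]
    at u₄ i₄ j₄ a₄ v₄
  have h₅ := emits_emit O 4 10 (entryExpr x) (s₄.setReg 23 b)
  classical
  rw [eval_entryExpr (u := ⟨u, hu⟩) (v := ⟨v, hv⟩) (a := a) (b := b) (i := i) (j := j) r₄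
    (by simpa using i₄) (by simpa [hx'] using j₄) (by simpa using u₄) (by simpa using a₄)
    (by simpa using v₄) (by simp)] at h₅
  rw [markedEntry, dif_pos ⟨hu, hv⟩]
  convert h₅

theorem eval_writeQuery (h : Ready e X s) {i j : ℕ} (hi : s.reg 17 = i) (hj : s.reg 18 = j)
    (hN : s.reg 31 = n * (n + 3)) :
    (writeQuery.eval O s).word 4 ((writeQuery.eval O s).reg 10) =
      graphPairWord (X.markedGraph i i) (X.markedGraph i j) := by
  have r₁ := h.setReg (x := 10) rfl 0
  have e₁ := emits_emit O 4 10 (.var 31) (s.setReg 10 0)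
  have e₂ := emits_emit O 4 10 (.var 31) ((emit 4 10 (.var 31)).eval O (s.setReg 10 0))
  have f₁ := frame_eval O (emit 4 10 (.var 31)) (s.setReg 10 0)
  have f₂ := frame_eval O (emit 4 10 (.var 31)) ((emit 4 10 (.var 31)).eval O (s.setReg 10 0))
  have r₂ := (r₁.of_frame f₁ rfl rfl).of_frame f₂ rfl rfl
  have i₂ := (f₂.reg 17 rfl).trans ((f₁.reg 17 rfl).trans hi)
  have j₂ := (f₂.reg 18 rfl).trans ((f₁.reg 18 rfl).trans hj)
  have N₁ := (f₁.reg 31 rfl).trans hN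
  have e₃ := emits_emitMarkedGraph (O := O) r₂ (Or.inl rfl) i₂ i₂
  have f₃ := frame_eval O (emitMarkedGraph 17) ((emit 4 10 (.var 31)).eval O
    ((emit 4 10 (.var 31)).eval O (s.setReg 10 0)))
  have e₄ := emits_emitMarkedGraph (O := O) (r₂.of_frame f₃ rfl rfl) (Or.inr rfl)
    ((f₃.reg 17 rfl).trans i₂) ((f₃.reg 18 rfl).trans j₂)
  have e₅ := e₁.seq (e₂.seq (e₃.seq e₄))
  have hN' : (Expr.var 31).eval (s.setReg 10 0) = n * (n + 3) := by simpa [Expr.eval] using hN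
  have hN₁ : (Expr.var 31).eval ((emit 4 10 (.var 31)).eval O (s.setReg 10 0)) = n * (n + 3) := N₁
  rw [hN', hN₁] at e₅
  -- The write position was reset to 0, so the word starts empty; letters of an earlier query left
  -- in the bank do not matter.
  change _ = [] ++ _ at e₅
  exact e₅

theorem eval_isMultiple {f y a t : ℕ} (hf : f ≠ 27 ∧ f ≠ 30 ∧ f ≠ y ∧ f ≠ a ∧ f ≠ t)
    (h27 : 27 ≠ y ∧ 27 ≠ a ∧ 27 ≠ t) (h30 : 30 ≠ a ∧ 30 ≠ t) :
    ((isMultiple f y a t).eval O s).reg f ≠ 0 ↔ ∃ q < s.reg y, q * s.reg a = s.reg t := by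
  -- The machine cannot multiply or divide: register `27` runs through the multiples of the
  -- candidate divisor by repeated addition.
  have h := eval_loop_induction (O := O) (x := 30) (y := y)
    (s := (s.setReg f 0).setReg 27 0)
    (P := seq (set f (.add (.var f) (.eq (.var 27) (.var t)))) (set 27 (.add (.var 27) (.var a))))
    (fun k s' => s'.reg 27 = k * s.reg a ∧ (s'.reg f ≠ 0 ↔ ∃ q < k, q * s.reg a = s.reg t))
    (by simp [hf]) ?_
  · have hy : ((s.setReg f 0).setReg 27 0).reg y = s.reg y := by
      simp [hf.2.2.1.symm, h27.1.symm]
    rw [hy] at h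
    exact h.2
  · intro k hk s' fr ⟨i₁, i₂⟩
    have ha := fr.reg a (by simp [writesReg, hf.2.2.2.1.symm, h27.2.1.symm, h30.1.symm])
    have ht := fr.reg t (by simp [writesReg, hf.2.2.2.2.symm, h27.2.2.symm, h30.2.symm])
    have ha' : s'.reg a = s.reg a := by simpa [hf.2.2.2.1.symm, h27.2.1.symm] using ha
    have ht' : s'.reg t = s.reg t := by simpa [hf.2.2.2.2.symm, h27.2.2.symm] using ht
    simp only [eval, Expr.eval, Expr.eval_eq, State.setReg_reg, hf.1, hf.1.symm, hf.2.1,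
      hf.2.2.2.1.symm, h30.1.symm, h30.2.symm, if_true, if_false, ha', ht', i₁,
      Nat.reduceEqDiff]
    refine ⟨by ring, ?_⟩
    have : (∃ q < k + 1, q * s.reg a = s.reg t) ↔
        (∃ q < k, q * s.reg a = s.reg t) ∨ k * s.reg a = s.reg t := by
      constructor
      · rintro ⟨q, hq, h⟩
        rcases Nat.lt_succ_iff_lt_or_eq.1 hq with hq | rfl
        · exact Or.inl ⟨q, hq, h⟩
        · exact Or.inr h
      · rintro (⟨q, hq, h⟩ | h)
        · exact ⟨q, by omega, h⟩
        · exact ⟨k, by omega, h⟩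
    rw [this, ← i₂]
    split_ifs with h <;> simp [h]

end OracleRAM

/-! ### Correctness of the orbit lengths and of the search for a common divisor -/

namespace OracleRAM

open Cmd

variable {G : Type} [Group G] {m n : ℕ} {O : Set Word} {e : Fin m ≃ G} {X : SimpleGraph (Fin n)}
  {s : State}

theorem eval_orbitLength (hO : ∀ q ∈ graphIsomorphism.instances, q ∈ O ↔ q ∈ graphIsomorphism.yes)
    (h : Ready e X s) {i : Fin n} (hi : s.reg 17 = i) (hN : s.reg 31 = n * (n + 3)) :
    (orbitLength.eval O s).reg 19 = (X.basicOrbit i).ncard := by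
  classical
  have r₁ := h.setReg (x := 19) rfl 0
  rw [orbitLength, eval, eval_loop_sum 19 fun j => if ∃ hj : j < n, ⟨j, hj⟩ ∈ X.basicOrbit i then
    1 else 0]
  · simp only [eval, Expr.eval]
    rw [r₁.reg_two, ← ncard_eq_card_filter (X.basicOrbit i)]
    · simp
    · simp
  · intro j hj s' hf
    simp only [eval, Expr.eval] at hf hj
    rw [r₁.reg_two] at hj
    have r₂ := (r₁.of_frame hf rfl rfl).setReg (x := 18) rfl j
    have i₂ : (s'.setReg 18 j).reg 17 = i := (hf.reg 17 rfl).trans hi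
    have N₂ : (s'.setReg 18 j).reg 31 = n * (n + 3) := (hf.reg 31 rfl).trans hN
    have j₂ : (s'.setReg 18 j).reg 18 = j := by simp
    have hw := eval_writeQuery (O := O) r₂ i₂ j₂ N₂
    have hd : (writeQuery.eval O (s'.setReg 18 j)).reg 19 = s'.reg 19 :=
      (frame_eval O writeQuery (s'.setReg 18 j)).reg 19 rfl
    have hq : graphPairWord (X.markedGraph i i) (X.markedGraph i j) ∈ O ↔
        ∃ hj : j < n, ⟨j, hj⟩ ∈ X.basicOrbit i := by
      -- The submitted word encodes a pair of graphs, so the oracle is bound to answer it correctly.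
      rw [hO _ ⟨_, _, _, _, rfl⟩, graphPairWord_mem_yes_iff,
        X.nonempty_iso_markedGraph_iff i ⟨j, hj⟩]
      exact ⟨fun h => ⟨hj, h⟩, fun ⟨_, h⟩ => h⟩
    simp only [eval, Expr.eval, hw, hq, State.setReg_reg, hd]
    simp

theorem queryBound_orbitLength (h : Ready e X s) {i : ℕ} (hi : s.reg 17 = i)
    (hN : s.reg 31 = n * (n + 3)) :
    orbitLength.QueryBound O (2 * (n * (n + 3) + 1) + 4 * ((n * (n + 3)) * (n * (n + 3)))) s := by
  have r₁ := h.setReg (x := 19) rfl 0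
  refine ⟨trivial, queryBound_loop fun j hj s' hf => ⟨queryFree.queryBound rfl _, ?_, trivial⟩⟩
  have r₂ := (r₁.of_frame hf rfl rfl).setReg (x := 18) rfl j
  have i₂ : (s'.setReg 18 j).reg 17 = i := (hf.reg 17 rfl).trans hi
  have N₂ : (s'.setReg 18 j).reg 31 = n * (n + 3) := (hf.reg 31 rfl).trans hN
  have hw := eval_writeQuery (O := O) r₂ i₂ (show (s'.setReg 18 j).reg 18 = j by simp) N₂
  change wordSize ((writeQuery.eval O (s'.setReg 18 j)).word 4
    ((writeQuery.eval O (s'.setReg 18 j)).reg 10)) ≤ _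
  rw [hw]
  exact wordSize_graphPairWord_le _ _

/-- When register `15` holds the order of `G'`, the equation `q * (k * |G'|) = m` says that `k`
divides the index of `G'`, without a division. Register `26` follows `k * |G'|` by repeated
addition, and `k ≥ 2` is tested as `k - 1 ≠ 0`. -/
theorem eval_searchDivisor (h : Ready e X s) :
    (searchDivisor.eval O s).reg 16 ≠ 0 ↔ s.reg 16 ≠ 0 ∨ ∃ k < n + 1, 2 ≤ k ∧
      (∃ q < m + 1, q * (k * s.reg 15) = m) ∧ ∃ q < n + 1, q * k = s.reg 19 := by
  have r₁ := h.setReg (x := 26) rfl 0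
  have h₁ := eval_loop_induction (O := O) (x := 25) (y := 5) (s := s.setReg 26 0)
    (P := seq (isMultiple 28 4 26 1) (seq (isMultiple 29 5 25 19)
    (seq (set 16 (.add (.var 16) (.and (.sub (.var 25) (.lit 1)) (.and (.var 28) (.var 29)))))
      (set 26 (.add (.var 26) (.var 15))))))
    (fun b s' => s'.reg 26 = b * s.reg 15 ∧ (s'.reg 16 ≠ 0 ↔ s.reg 16 ≠ 0 ∨ ∃ k < b, 2 ≤ k ∧
      (∃ q < m + 1, q * (k * s.reg 15) = m) ∧ ∃ q < n + 1, q * k = s.reg 19)) (by simp) ?_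
  · rw [r₁.reg_five] at h₁
    exact h₁.2
  intro k hk s' hf ⟨i₁, i₂⟩
  have r₂ := (r₁.of_frame hf rfl rfl).setReg (x := 25) rfl k
  have h15 : s'.reg 15 = s.reg 15 := hf.reg 15 rfl
  have h19 : s'.reg 19 = s.reg 19 := hf.reg 19 rfl
  set s₁ := s'.setReg 25 k with hs₁
  set s₂ := (isMultiple 28 4 26 1).eval O s₁ with hs₂
  set s₃ := (isMultiple 29 5 25 19).eval O s₂ with hs₃
  have f₂ : Frame _ s₁ s₂ := frame_eval O (isMultiple 28 4 26 1) s₁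
  have f₃ : Frame _ s₂ s₃ := frame_eval O (isMultiple 29 5 25 19) s₂
  have r₃ := r₂.of_frame f₂ rfl rfl
  have m₁ : s₂.reg 28 ≠ 0 ↔ _ := eval_isMultiple (O := O) (s := s₁) (f := 28) (y := 4) (a := 26)
    (t := 1) (by decide) (by decide) (by decide)
  have m₂ : s₃.reg 29 ≠ 0 ↔ _ := eval_isMultiple (O := O) (s := s₂) (f := 29) (y := 5) (a := 25)
    (t := 19) (by decide) (by decide) (by decide)
  have k₁ : s₁.reg 26 = k * s.reg 15 := by simpa [hs₁] using i₁
  have k₂ : s₂.reg 25 = k := (f₂.reg 25 rfl).trans (by simp [hs₁])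
  have d₂ : s₂.reg 19 = s.reg 19 := (f₂.reg 19 rfl).trans (by simpa [hs₁] using h19)
  rw [r₂.reg_four, r₂.reg_one, k₁] at m₁
  rw [r₃.reg_five, k₂, d₂] at m₂
  have a₁ : s₃.reg 28 = s₂.reg 28 := f₃.reg 28 rfl
  have a₂ : s₃.reg 25 = k := (f₃.reg 25 rfl).trans k₂
  have a₃ : s₃.reg 16 = s'.reg 16 := (f₃.reg 16 rfl).trans ((f₂.reg 16 rfl).trans (by simp [hs₁]))
  have a₄ : s₃.reg 15 = s.reg 15 :=
    (f₃.reg 15 rfl).trans ((f₂.reg 15 rfl).trans (by simpa [hs₁] using h15))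
  have a₅ : s₃.reg 26 = k * s.reg 15 := (f₃.reg 26 rfl).trans ((f₂.reg 26 rfl).trans k₁)
  simp only [eval, ← hs₂, ← hs₃, Expr.eval, Expr.eval_and, State.setReg_reg, a₁, a₂, a₃, a₄, a₅,
    if_true, if_false, Nat.reduceEqDiff, m₁, m₂, ne_eq, ite_eq_right_iff, one_ne_zero, imp_false,
    not_not]
  refine ⟨by ring, ?_⟩
  have hsum : ∀ (a : ℕ) (p : Prop) [Decidable p], ¬ (a + if p then 1 else 0) = 0 ↔ a ≠ 0 ∨ p := by
    intro a p _
    split_ifs with hp <;> simp [hp]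
  rw [hsum, i₂, or_assoc]
  refine or_congr_right ?_
  constructor
  · rintro (⟨l, hl, h⟩ | ⟨h₁, h₂, h₃⟩)
    · exact ⟨l, by omega, h⟩
    · exact ⟨k, by omega, by omega, h₂, h₃⟩
  · rintro ⟨l, hl, h⟩
    rcases Nat.lt_succ_iff_lt_or_eq.1 hl with hl | rfl
    · exact Or.inl ⟨l, hl, h⟩
    · exact Or.inr ⟨by omega, h.2⟩

theorem eval_searchVertices
    (hO : ∀ q ∈ graphIsomorphism.instances, q ∈ O ↔ q ∈ graphIsomorphism.yes)
    (h : Ready e X s) (hN : s.reg 31 = n * (n + 3)) (h16 : s.reg 16 = 0) :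
    (searchVertices.eval O s).reg 16 ≠ 0 ↔ ∃ i : Fin n, ∃ k < n + 1, 2 ≤ k ∧
      (∃ q < m + 1, q * (k * s.reg 15) = m) ∧ ∃ q < n + 1, q * k = (X.basicOrbit i).ncard := by
  have h₁ := eval_loop_induction (O := O) (x := 17) (y := 2) (s := s)
    (P := seq orbitLength searchDivisor)
    (fun b s' => s'.reg 16 ≠ 0 ↔ ∃ i : Fin n, (i : ℕ) < b ∧ ∃ k < n + 1, 2 ≤ k ∧
      (∃ q < m + 1, q * (k * s.reg 15) = m) ∧ ∃ q < n + 1, q * k = (X.basicOrbit i).ncard)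
    (by simp [h16]) ?_
  · rw [searchVertices, h₁, h.reg_two]
    simp
  intro i hi s' hf ih
  rw [h.reg_two] at hi
  have r₁ := (h.of_frame hf rfl rfl).setReg (x := 17) rfl i
  have f₁ := frame_eval O orbitLength (s'.setReg 17 i)
  have N₁ : (s'.setReg 17 i).reg 31 = n * (n + 3) := (hf.reg 31 rfl).trans hN
  have d₁ := eval_orbitLength hO r₁ (i := ⟨i, hi⟩) (by simp) N₁
  have h15 : (orbitLength.eval O (s'.setReg 17 i)).reg 15 = s.reg 15 :=
    (f₁.reg 15 rfl).trans (hf.reg 15 rfl)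
  have h16 : (orbitLength.eval O (s'.setReg 17 i)).reg 16 = s'.reg 16 := f₁.reg 16 rfl
  rw [eval, eval_searchDivisor (r₁.of_frame f₁ rfl rfl), d₁, h15, h16, ih]
  constructor
  · rintro (⟨j, hj, h⟩ | h)
    · exact ⟨j, by omega, h⟩
    · exact ⟨⟨i, hi⟩, by simp, h⟩
  · rintro ⟨j, hj, h⟩
    rcases Nat.lt_succ_iff_lt_or_eq.1 hj with hj | rfl
    · exact Or.inl ⟨j, hj, h⟩
    · exact Or.inr h

theorem queryBound_searchVertices (h : Ready e X s) (hN : s.reg 31 = n * (n + 3)) :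
    searchVertices.QueryBound O
      (2 * (n * (n + 3) + 1) + 4 * ((n * (n + 3)) * (n * (n + 3)))) s := by
  refine queryBound_loop fun i hi s' hf => ⟨?_, queryFree.queryBound rfl _⟩
  exact queryBound_orbitLength ((h.of_frame hf rfl rfl).setReg (x := 17) rfl i) (i := i) (by simp)
    ((hf.reg 31 rfl).trans hN)

/-! ### Reading the input, and the whole algorithm -/

/-- The sizes have been read. -/
structure Sized (e : Fin m ≃ G) (X : SimpleGraph (Fin n)) (s : State) : Prop where
  reg_one : s.reg 1 = m
  reg_two : s.reg 2 = n
  reg_three : s.reg 3 = n + 3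
  reg_four : s.reg 4 = m + 1
  reg_five : s.reg 5 = n + 1
  input : ∀ i, s.mem 0 i = (groupGraphWord e X).getD i 0
  blank : s.mem 3 = 0

theorem sized_readSizes (e : Fin m ≃ G) (X : SimpleGraph (Fin n)) :
    Sized e X (readSizes.eval O (init (groupGraphWord e X))) := by
  constructor <;> try simp [readSizes, eval, Expr.eval, init, groupGraphWord]
  rfl

/-- A loop that stores the addresses `p, p + l, p + 2 * l, …` in a memory bank. -/
theorem eval_rows {b y p l N : ℕ} (hp : s.reg 10 = p) (hy : s.reg y = l) (hN : y ≠ 10 ∧ y ≠ 11)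
    (hl : l = N) :
    ((loop 11 y (seq (store b (.var 11) (.var 10)) (set 10 (.add (.var 10) (.var y))))).eval O
      s).reg 10 = p + N * l ∧
    ∀ i < N, ((loop 11 y (seq (store b (.var 11) (.var 10))
      (set 10 (.add (.var 10) (.var y))))).eval O s).mem b i = p + i * l := by
  have h := eval_loop_induction (O := O) (x := 11) (y := y) (s := s)
    (P := seq (store b (.var 11) (.var 10)) (set 10 (.add (.var 10) (.var y))))
    (fun k s' => s'.reg 10 = p + k * l ∧ ∀ i < k, s'.mem b i = p + i * l) (by simp [hp]) ?_
  · rw [hy, hl] at h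
    rwa [hl]
  intro k hk s' hf ⟨i₁, i₂⟩
  have hy' : s'.reg y = l := (hf.reg y (by simp [writesReg, hN])).trans hy
  refine ⟨?_, fun i hi => ?_⟩
  · simp [eval, Expr.eval, i₁, hN, hy']
    ring
  · simp only [eval, Expr.eval, State.setReg_mem, State.setMem_mem, State.setReg_reg, if_true,
      true_and, i₁, Nat.reduceEqDiff, if_false]
    split_ifs with h
    · rw [h]
    · exact i₂ i (by omega)

theorem ready_computeRows (h : Sized e X s) :
    Ready e X (computeRows.eval O s) ∧ (computeRows.eval O s).mem 3 = 0 := by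
  have f := frame_eval O computeRows s
  refine ⟨⟨?_, ?_, ?_, ?_, ?_, ?_, ?_⟩, (f.mem 3 rfl).trans h.blank⟩
  · exact (f.reg 1 rfl).trans h.reg_one
  · exact (f.reg 2 rfl).trans h.reg_two
  · exact (f.reg 3 rfl).trans h.reg_three
  · exact (f.reg 4 rfl).trans h.reg_four
  · exact (f.reg 5 rfl).trans h.reg_five
  -- Both tables are addressed from the same two loops. The input starts with the letters `m` and
  -- `n`, so the multiplication table begins at address `2` and the adjacency matrix at `2 + m * m`.
  all_goals
    have h₁ := eval_rows (O := O) (b := 1) (y := 1) (s := s.setReg 10 2) (p := 2) (by simp)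
      (show _ = m by simpa using h.reg_one) (by decide) rfl
    set s₁ := (loop 11 1 (seq (store 1 (.var 11) (.var 10))
      (set 10 (.add (.var 10) (.var 1))))).eval O (s.setReg 10 2) with hs₁
    have f₁ : Frame (loop 11 1 (seq (store 1 (.var 11) (.var 10))
      (set 10 (.add (.var 10) (.var 1))))) (s.setReg 10 2) s₁ := frame_eval _ _ _
    have h₂ := eval_rows (O := O) (b := 2) (y := 2) (s := s₁) h₁.1
      (show _ = n from (f₁.reg 2 rfl).trans (by simpa using h.reg_two)) (by decide) rfl
    set s₂ := (loop 11 2 (seq (store 2 (.var 11) (.var 10))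
      (set 10 (.add (.var 10) (.var 2))))).eval O s₁ with hs₂
    have f₂ : Frame (loop 11 2 (seq (store 2 (.var 11) (.var 10))
      (set 10 (.add (.var 10) (.var 2))))) s₁ s₂ := frame_eval _ _ _
    have hs : computeRows.eval O s = s₂ := rfl
    rw [hs] at f ⊢
    intro i j
    have hlt {N : ℕ} (i j : Fin N) : (i * N + j : ℕ) < N * N := by
      calc (i * N + j : ℕ) < i * N + N := by omega
        _ = (i + 1) * N := by ring
        _ ≤ N * N := Nat.mul_le_mul_right _ i.2
    have hij := hlt i j
    rw [f.mem 0 rfl, h.input, groupGraphWord]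
  · have e₁ : s₂.mem 1 i = 2 + i * m := by rw [f₂.mem 1 rfl, h₁.2 i i.2]
    rw [e₁, show 2 + i * m + j = (i * m + j) + 1 + 1 by ring, List.getD_cons_succ,
      List.getD_cons_succ, List.getD_eq_getElem?_getD,
      List.getElem?_append_left (by rwa [length_tableWord]), getElem?_tableWord]
    rfl
  · rw [h₂.2 i i.2, show 2 + m * m + i * n + j = (m * m + (i * n + j)) + 1 + 1 by ring,
      List.getD_cons_succ, List.getD_cons_succ, List.getD_eq_getElem?_getD,
      List.getElem?_append_right (by rw [length_tableWord]; omega), length_tableWord,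
      Nat.add_sub_cancel_left, getElem?_adjWord]
    rfl

/-- The state after the order of the commutator subgroup and the number of vertices of the
queries have been computed. -/
theorem ready_prepare [Finite G] (h : Sized e X s) {s' : State}
    (hs' : s' = (set 16 (.lit 0)).eval O ((loop 11 2 (set 31 (.add (.var 31) (.var 3)))).eval O
      ((set 31 (.lit 0)).eval O (commutatorOrder.eval O (computeRows.eval O s))))) :
    Ready e X s' ∧ s'.reg 15 = Nat.card (commutator G) ∧ s'.reg 31 = n * (n + 3) ∧
      s'.reg 16 = 0 := by
  obtain ⟨r₁, b₁⟩ := ready_computeRows (O := O) h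
  have c₁ := eval_commutatorOrder (O := O) r₁ b₁
  have r₂ := r₁.of_frame (frame_eval O commutatorOrder _) rfl rfl
  set s₂ := commutatorOrder.eval O (computeRows.eval O s)
  have r₃ := r₂.setReg (x := 31) rfl 0
  have f₃ := frame_eval O (loop 11 2 (set 31 (.add (.var 31) (.var 3)))) (s₂.setReg 31 0)
  have N₃ := eval_loop_sum (O := O) (x := 11) (y := 2) (s := s₂.setReg 31 0)
    (P := set 31 (.add (.var 31) (.var 3))) 31 (fun _ => n + 3) (by
      intro k hk s' hf
      have r := r₃.of_frame hf rfl rfl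
      simp [eval, Expr.eval, r.reg_three])
  rw [r₃.reg_two] at N₃
  subst hs'
  refine ⟨(r₃.of_frame f₃ rfl rfl).setReg (x := 16) rfl 0, ?_, ?_, ?_⟩
  · exact (f₃.reg 15 rfl).trans c₁
  · exact N₃.trans (by simp)
  · simp [eval, Expr.eval]

theorem eval_decideSized [Finite G]
    (hO : ∀ q ∈ graphIsomorphism.instances, q ∈ O ↔ q ∈ graphIsomorphism.yes) (h : Sized e X s) :
    (decideSized.eval O s).reg 0 ≠ 0 ↔ ∃ i : Fin n, ∃ k < n + 1, 2 ≤ k ∧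
      (∃ q < m + 1, q * (k * Nat.card (commutator G)) = m) ∧
        ∃ q < n + 1, q * k = (X.basicOrbit i).ncard := by
  obtain ⟨r, h₁, h₂, h₃⟩ := ready_prepare (O := O) h rfl
  rw [← h₁]
  exact eval_searchVertices hO r h₂ h₃

theorem queryBound_decideSized [Finite G] (h : Sized e X s) :
    decideSized.QueryBound O
      (2 * (n * (n + 3) + 1) + 4 * ((n * (n + 3)) * (n * (n + 3)))) s := by
  obtain ⟨r, -, h₂, -⟩ := ready_prepare (O := O) h rfl
  exact ⟨queryFree.queryBound rfl _, queryFree.queryBound rfl _, trivial,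
    queryFree.queryBound rfl _, trivial, queryBound_searchVertices r h₂, trivial⟩

end OracleRAM

/-! ### The reduction -/

theorem SimpleGraph.ncard_basicOrbit_pos {n : ℕ} (X : SimpleGraph (Fin n)) (i : Fin n) :
    0 < (X.basicOrbit i).ncard :=
  (Set.ncard_pos).2 ⟨i, 1, (X.fixing i).one_mem, rfl⟩

/-- The condition that the algorithm tests. -/
theorem exists_common_divisor_iff {G : Type} [Group G] [Finite G] {m n : ℕ}
    (hm : Nat.card G = m) (X : SimpleGraph (Fin n)) :
    (∃ i : Fin n, ∃ k < n + 1, 2 ≤ k ∧ (∃ q < m + 1, q * (k * Nat.card (commutator G)) = m) ∧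
        ∃ q < n + 1, q * k = (X.basicOrbit i).ncard) ↔
      ∃ p : ℕ, p.Prime ∧ p ∣ Nat.card (G ⧸ commutator G) ∧ p ∣ Nat.card (X ≃g X) := by
  have hG : m = Nat.card (G ⧸ commutator G) * Nat.card (commutator G) := by
    rw [← hm, ← Subgroup.card_eq_card_quotient_mul_card_subgroup]
  have hpos : 0 < Nat.card (commutator G) := Nat.card_pos
  constructor
  · rintro ⟨i, k, -, hk, ⟨q, -, hq⟩, ⟨r, -, hr⟩⟩
    have h₁ : k ∣ Nat.card (G ⧸ commutator G) := by
      refine ⟨q, Nat.eq_of_mul_eq_mul_right hpos ?_⟩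
      rw [← hG, ← hq]
      ring
    have h₂ : k ∣ Nat.card (X ≃g X) := by
      rw [X.card_aut_eq_prod]
      exact (Dvd.intro_left r hr).trans (Finset.dvd_prod_of_mem _ (Finset.mem_univ i))
    -- The search admits composite `k`; any prime factor of `k` serves.
    exact ⟨k.minFac, Nat.minFac_prime (by omega), (Nat.minFac_dvd k).trans h₁,
      (Nat.minFac_dvd k).trans h₂⟩
  · rintro ⟨p, hp, ⟨q, hq⟩, h₂⟩
    -- Being prime, `p` divides a single orbit length. This is at most `n`, which puts `p` and the
    -- cofactor `r` within the range of the search.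
    rw [X.card_aut_eq_prod, hp.prime.dvd_finsetProd_iff] at h₂
    obtain ⟨i, -, r, hr⟩ := h₂
    have hle : (X.basicOrbit i).ncard ≤ n := by
      simpa using Set.ncard_le_card (X.basicOrbit i)
    have hpi := X.ncard_basicOrbit_pos i
    have hm' : m = q * (p * Nat.card (commutator G)) := by
      rw [hG, hq]
      ring
    have hp0 := hp.pos
    have h₁ : p ≤ (X.basicOrbit i).ncard := Nat.le_of_dvd hpi ⟨r, hr⟩
    have h₃ : r ≤ (X.basicOrbit i).ncard := Nat.le_of_dvd hpi ⟨p, by rw [hr, mul_comm]⟩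
    have h₄ : q ≤ m := by
      rw [hm']
      exact Nat.le_mul_of_pos_right q (Nat.mul_pos hp0 hpos)
    exact ⟨i, p, by omega, hp.two_le, ⟨q, by omega, hm'.symm⟩, r, by omega, by rw [hr, mul_comm]⟩

theorem solvableRepresentability_reducible :
    PolyTimeTuringReducible solvableRepresentability graphIsomorphism := by
  -- Here `N` evaluates at `n` to the number of vertices of a marked graph, and `q` to a bound on
  -- the bit length of a query about two such graphs.
  let N : Polynomial ℕ := .X * (.X + .C 3)
  let q : Polynomial ℕ := .C 2 * (N + .C 1) + .C 4 * (N * N)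
  refine ⟨(OracleRAM.Cmd.seq OracleRAM.readSizes OracleRAM.decideSized).compile 0,
    OracleRAM.readSizes.timeBound q + OracleRAM.decideSized.timeBound q, fun O hO w hw => ?_⟩
  obtain ⟨G, _, m, n, e, X, hG, rfl⟩ := hw
  have : Finite G := Finite.of_equiv _ e
  have hm : Nat.card G = m := by rw [← Nat.card_congr e, Nat.card_fin]
  -- The initial state represents itself: only register `0` can be nonzero, and it holds the
  -- variable `0`.
  have hsim : OracleRAM.Sim (OracleRAM.init (groupGraphWord e X))
      (OracleRAM.init (groupGraphWord e X)) := ⟨rfl, fun x => by simp [OracleRAM.init]⟩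
  obtain ⟨t, s, he, ht, hs, -⟩ :=
    (OracleRAM.Cmd.seq OracleRAM.readSizes OracleRAM.decideSized).exec O 0 hsim
  have hz := OracleRAM.sized_readSizes (O := O) e X
  refine ⟨t, s, he, ht.trans ?_, ?_⟩
  · obtain ⟨hmw, hnw⟩ := le_wordSize_groupGraphWord e X
    rw [Polynomial.eval_add]
    refine Nat.add_le_add ?_ (OracleRAM.Cmd.cost_le_timeBound rfl (fun r hr => ?_) ?_)
    -- Reading the sizes takes constant time; only afterwards do the loop bounds have their final
    -- values, so this phase is treated separately.
    · simp [OracleRAM.readSizes, OracleRAM.Cmd.cost, OracleRAM.Cmd.timeBound]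
    · simp only [OracleRAM.Cmd.isSize, Bool.and_eq_true, decide_eq_true_eq] at hr
      obtain ⟨h₁, h₂⟩ := hr
      interval_cases r
      · rw [hz.reg_one]; omega
      · rw [hz.reg_two]; omega
      · rw [hz.reg_three]; omega
      · rw [hz.reg_four]; omega
      · rw [hz.reg_five]; omega
    · refine (OracleRAM.queryBound_decideSized hz).mono ?_
      simp only [q, N, Polynomial.eval_add, Polynomial.eval_mul, Polynomial.eval_C,
        Polynomial.eval_X]
      gcongr
  · rw [groupGraphWord_mem_yes_iff, representable_iff_common_prime G (Fin n) X,
      ← exists_common_divisor_iff hm X, ← OracleRAM.eval_decideSized hO hz]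
    have h0 : s.reg 0 = _ := hs.reg 0
    rw [h0]
    rfl

theorem mainTheorem2 :
    PolyTimeTuringReducible solvableRepresentability graphIsomorphism ∧
    ∀ (G : Type*) [Group G] [Finite G] [Group.IsSolvable G] (V : Type*) [Finite V] (X : SimpleGraph V),
      Representable G X ↔
        ∃ p : ℕ, p.Prime ∧ p ∣ Nat.card (G ⧸ commutator G) ∧ p ∣ Nat.card (X ≃g X) :=
  ⟨solvableRepresentability_reducible, fun G _ _ _ V _ X => representable_iff_common_prime G V X⟩
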